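/- Let $\mathbb D$ be the open unit disc, $\mathbb T$ its boundary, and let $\mathcal A$ be the Neil algebra: the unital algebra of all functions $f$ that are continuous on $\overline{\mathbb D}$, analytic on $\mathbb D$, and satisfy $f'(0)=0$. For $F\in M_n(\mathcal A)$ put $\|F\|_n=\sup_{z\in\mathbb D}\|F(z)\|$ (operator norm of $n\times n$ matrices). A representation of $\mathcal A$ on a Hilbert space $H$ is an algebra homomorphism $\pi:\mathcal A\to B(H)$. It is - unital if $\pi(1)=I$; - completely contractive if $\|(\pi(F_{jk}))_{j,k}\|_{B(H^{\oplus n})}\le\|F\|_n$ for all $n$ and all $F\in M_n(\mathcal A)$; - pure if $\bigcap_a \pi(a)H=(0)$, where $a$ runs over the inner elements of $\mathcal A$, i.e. those with $|a|=1$ on $\mathbb T$; - extremal if, whenever $\rho:\mathcal A\to B(K)$ is a completely contractive representation on a Hilbert space $K$ and $V:H\to K$ is an isometry with $\pi(a)=V^*\rho(a)V$ for all $a\in\mathcal A$, then $V\pi(a)=\rho(a)V$ for all $a\in\mathcal A$; - of rank one if there do not exist two nonzero closed subspaces of $H$ that are orthogonal to each other and both invariant under $\pi(a)$ for all $a\in\mathcal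 A$. For a subspace $\mathcal V\subset\mathbb C\oplus\mathbb Cz$ of the Hardy space $\mathrm H^2\subset L^2(\mathbb T)$ let $\mathrm H^2_{\mathcal V}=\mathrm H^2\ominus\mathcal V$ and let $\pi_{\mathcal V}:\mathcal A\to B(\mathrm H^2_{\mathcal V})$ be the representation $\pi_{\mathcal V}(a)f=af$. Corollary. For every subspace $\mathcal V\subset\mathbb C\oplus\mathbb Cz$ the representation $\pi_{\mathcal V}$ has rank one. Moreover, if $\pi$ is a unital, pure, extremal, completely contractive, rank one representation of $\mathcal A$ on a nonzero Hilbert space, then there is a subspace $\mathcal V\subset\mathbb C\oplus\mathbb Cz$ such that $\pi$ is unitarily equivalent to $\pi_{\mathcal V}$. -/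

import Mathlib

open MeasureTheory Metric AddCircle
open scoped ENNReal InnerProductSpace

universe u v

noncomputable section

namespace NeilAlg

/-! ### The disc algebra and the Neil algebra -/

/-- The closed unit disc of `ℂ`. -/
abbrev Disc : Type := closedBall (0 : ℂ) 1

open Classical in
/-- A function on the closed unit disc, extended by `0` to all of `ℂ`.  Only its values on the
closed disc, and its derivatives at points of the open disc, are ever used. -/
def ext0 (f : C(Disc, ℂ)) : ℂ → ℂ :=
  fun z => if h : z ∈ closedBall (0 : ℂ) 1 then f ⟨z, h⟩ else 0

theorem ext0_of_mem (f : C(Disc, ℂ)) {z : ℂ} (h : z ∈ closedBall (0 : ℂ) 1) :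
    ext0 f z = f ⟨z, h⟩ := by
  simp only [ext0, dif_pos h]

theorem ext0_mul (f g : C(Disc, ℂ)) : ext0 (f * g) = ext0 f * ext0 g := by
  funext z
  by_cases h : z ∈ closedBall (0 : ℂ) 1
  · simp [ext0_of_mem _ h]
  · simp only [ext0, dif_neg h, Pi.mul_apply, mul_zero]

theorem ext0_add (f g : C(Disc, ℂ)) : ext0 (f + g) = ext0 f + ext0 g := by
  funext z
  by_cases h : z ∈ closedBall (0 : ℂ) 1
  · simp [ext0_of_mem _ h]
  · simp only [ext0, dif_neg h, Pi.add_apply, add_zero]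

theorem ext0_algebraMap_eqOn (c : ℂ) :
    Set.EqOn (ext0 (algebraMap ℂ C(Disc, ℂ) c)) (fun _ => c) (ball 0 1) := by
  intro z hz
  rw [ext0_of_mem _ (ball_subset_closedBall hz)]
  simp

/-- The disc algebra: functions continuous on the closed unit disc and analytic on the open
unit disc. -/
def discAlgebra : Subalgebra ℂ C(Disc, ℂ) where
  carrier := {f | DifferentiableOn ℂ (ext0 f) (ball 0 1)}
  mul_mem' {f g} hf hg := by
    simp only [Set.mem_ofPred_eq] at hf hg ⊢
    rw [ext0_mul]; exact hf.mul hg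
  add_mem' {f g} hf hg := by
    simp only [Set.mem_ofPred_eq] at hf hg ⊢
    rw [ext0_add]; exact hf.add hg
  algebraMap_mem' c := (differentiableOn_const c).congr (ext0_algebraMap_eqOn c)

theorem differentiableAt_zero {f : C(Disc, ℂ)} (hf : f ∈ discAlgebra) :
    DifferentiableAt ℂ (ext0 f) 0 :=
  DifferentiableOn.differentiableAt (s := ball 0 1) hf (ball_mem_nhds 0 one_pos)

/-- The Neil algebra: the elements `f` of the disc algebra with `f'(0) = 0`. -/
def neilAlgebra : Subalgebra ℂ C(Disc, ℂ) where
  carrier := {f | f ∈ discAlgebra ∧ deriv (ext0 f) 0 = 0}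
  mul_mem' {f g} hf hg := by
    refine ⟨mul_mem hf.1 hg.1, ?_⟩
    rw [ext0_mul, deriv_mul (differentiableAt_zero hf.1) (differentiableAt_zero hg.1),
      hf.2, hg.2, zero_mul, mul_zero, add_zero]
  add_mem' {f g} hf hg := by
    refine ⟨add_mem hf.1 hg.1, ?_⟩
    rw [ext0_add, deriv_add (differentiableAt_zero hf.1) (differentiableAt_zero hg.1),
      hf.2, hg.2, add_zero]
  algebraMap_mem' c := by
    refine ⟨Subalgebra.algebraMap_mem _ c, ?_⟩
    rw [((ext0_algebraMap_eqOn c).eventuallyEq_of_mem (ball_mem_nhds 0 one_pos)).deriv_eq]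
    simp

/-- The norm of a matrix over the Neil algebra: the supremum over the open unit disc of the
operator norms of the scalar matrices `F(z)`. -/
def matNorm {n : ℕ} (F : Matrix (Fin n) (Fin n) neilAlgebra) : ℝ :=
  ⨆ z : ball (0 : ℂ) 1, ‖Matrix.toEuclideanCLM (n := Fin n) (𝕜 := ℂ)
    (Matrix.of fun j k => (F j k : C(Disc, ℂ)) ⟨z, ball_subset_closedBall z.2⟩)‖

/-- An element of the Neil algebra is inner if it is unimodular on the unit circle. -/
def IsInner (a : neilAlgebra) : Prop :=
  ∀ z : Disc, ‖(z : ℂ)‖ = 1 → ‖(a : C(Disc, ℂ)) z‖ = 1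

/-! ### Representations -/

section Representations

variable (H : Type u) [NormedAddCommGroup H] [InnerProductSpace ℂ H]

/-- A representation of the Neil algebra on `H`: a (not necessarily unital) algebra homomorphism
into the bounded operators on `H`. -/
abbrev Rep : Type u := neilAlgebra →ₙₐ[ℂ] (H →L[ℂ] H)

variable {H}

/-- The operator on the Hilbert space direct sum `H ⊕ ⋯ ⊕ H` given by a matrix of operators. -/
def blockOp {n : ℕ} (T : Matrix (Fin n) (Fin n) (H →L[ℂ] H)) :
    PiLp 2 (fun _ : Fin n => H) →L[ℂ] PiLp 2 (fun _ : Fin n => H) :=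
  (PiLp.continuousLinearEquiv 2 ℂ (fun _ : Fin n => H)).symm.toContinuousLinearMap ∘L
    ContinuousLinearMap.pi (fun j => ∑ k, T j k ∘L ContinuousLinearMap.proj k) ∘L
    (PiLp.continuousLinearEquiv 2 ℂ (fun _ : Fin n => H)).toContinuousLinearMap

theorem blockOp_apply {n : ℕ} (T : Matrix (Fin n) (Fin n) (H →L[ℂ] H))
    (x : PiLp 2 (fun _ : Fin n => H)) (j : Fin n) : blockOp T x j = ∑ k, T j k (x k) := by
  simp [blockOp]

/-- The representation is unital. -/
def IsUnital (π : Rep H) : Prop := π 1 = 1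

/-- The representation is completely contractive: for every `n`, its entrywise application to
`n × n` matrices is a contraction. -/
def IsCompletelyContractive (π : Rep H) : Prop :=
  ∀ (n : ℕ) (F : Matrix (Fin n) (Fin n) neilAlgebra), ‖blockOp (F.map π)‖ ≤ matNorm F

/-- The representation is pure: the ranges of the operators `π(a)`, `a` inner, have trivial
intersection. -/
def IsPure (π : Rep H) : Prop :=
  ∀ h : H, (∀ a : neilAlgebra, IsInner a → ∃ g : H, π a g = h) → h = 0

/-- The representation is extremal: every isometric compression to it of a completely contractive
representation is an intertwining. -/
def IsExtremal [CompleteSpace H] (π : Rep H) : Prop :=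
  ∀ (K : Type u) [NormedAddCommGroup K] [InnerProductSpace ℂ K] [CompleteSpace K]
    (ρ : Rep K) (V : H →ₗᵢ[ℂ] K), IsCompletelyContractive ρ →
    (∀ a, π a = ContinuousLinearMap.adjoint V.toContinuousLinearMap ∘L ρ a ∘L
      V.toContinuousLinearMap) →
    ∀ a, V.toContinuousLinearMap ∘L π a = ρ a ∘L V.toContinuousLinearMap

/-- The subspace `M` is invariant for the representation. -/
def IsInvariant (π : Rep H) (M : Submodule ℂ H) : Prop := ∀ a, ∀ x ∈ M, π a x ∈ M

/-- The representation has rank one: there is no pair of nonzero invariant subspaces that are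
orthogonal to each other. -/
def IsRankOne (π : Rep H) : Prop :=
  ¬ ∃ M N : Submodule ℂ H, IsClosed (M : Set H) ∧ IsClosed (N : Set H) ∧ M ≠ ⊥ ∧ N ≠ ⊥ ∧
    M ⟂ N ∧ IsInvariant π M ∧ IsInvariant π N

/-- Unitary equivalence of representations. -/
def UnitarilyEquiv {H' : Type v} [NormedAddCommGroup H'] [InnerProductSpace ℂ H']
    (π : Rep H) (π' : Rep H') : Prop :=
  ∃ U : H ≃ₗᵢ[ℂ] H', ∀ a h, U (π a h) = π' a (U h)

end Representations

/-! ### Hardy spaces on the circle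

The unit circle is parametrized by `t ∈ ℝ/ℤ`, `z = exp (2 π i t)`, with normalized arclength, so
that the function `z ^ n` is `fourier n`. -/

/-- `L²` of the unit circle. -/
abbrev L2 : Type := Lp ℂ 2 (haarAddCircle : Measure UnitAddCircle)

/-- The classical Hardy space `H²`: the functions in `L²` of the circle whose negative Fourier
coefficients vanish. -/
def H2 : Submodule ℂ L2 where
  carrier := {f | ∀ n : ℤ, n < 0 → ⟪fourierLp (T := 1) 2 n, f⟫_ℂ = 0}
  add_mem' hf hg n hn := by rw [inner_add_right, hf n hn, hg n hn, add_zero]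
  zero_mem' n _ := inner_zero_right _
  smul_mem' c f hf n hn := by rw [inner_smul_right, hf n hn, mul_zero]

/-- The subspace `ℂ ⊕ ℂ z` of `H²`. -/
def CCz : Submodule ℂ L2 :=
  Submodule.span ℂ {fourierLp (T := 1) 2 0, fourierLp (T := 1) 2 1}

/-- `H²_𝒱 = H² ⊖ 𝒱`. -/
def H2V (V : Submodule ℂ L2) : Submodule ℂ L2 := H2 ⊓ Vᗮ

/-- The parametrization `t ↦ exp (2 π i t)` of the unit circle. -/
def circ : C(UnitAddCircle, Disc) where
  toFun t := ⟨fourier 1 t, by simp [fourier_apply, Circle.norm_coe]⟩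
  continuous_toFun := by fun_prop

/-- The boundary values of a function on the closed disc. -/
def bdry (a : C(Disc, ℂ)) : C(UnitAddCircle, ℂ) := a.comp circ

/-- Multiplication by a continuous function on `L²` of the circle. -/
def mulL2 (g : C(UnitAddCircle, ℂ)) : L2 →L[ℂ] L2 :=
  (ContinuousLinearMap.mul ℂ ℂ).holderL haarAddCircle ∞ 2 2
    (ContinuousMap.toLp ∞ haarAddCircle ℂ g)

theorem coeFn_mulL2 (g : C(UnitAddCircle, ℂ)) (f : L2) :
    mulL2 g f =ᵐ[haarAddCircle] fun t => g t * f t := by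
  have h1 := (ContinuousLinearMap.mul ℂ ℂ).coeFn_holder (r := 2)
    (ContinuousMap.toLp (p := ∞) (haarAddCircle : Measure UnitAddCircle) ℂ g) f
  have h2 := ContinuousMap.coeFn_toLp (p := ∞) (𝕜 := ℂ)
    (haarAddCircle : Measure UnitAddCircle) g
  filter_upwards [h1, h2] with t h1 h2
  exact h1.trans (by rw [h2, ContinuousLinearMap.mul_apply'])

theorem inner_fourier_mul (g : C(UnitAddCircle, ℂ)) (n k : ℤ) :
    ⟪fourierLp (T := 1) 2 n, mulL2 g (fourierLp (T := 1) 2 k)⟫_ℂ = fourierCoeff g (n - k) := by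
  rw [L2.inner_def, fourierCoeff]
  refine integral_congr_ae ?_
  filter_upwards [coeFn_mulL2 g (fourierLp 2 k), coeFn_fourierLp (T := 1) 2 k,
    coeFn_fourierLp (T := 1) 2 n] with t h1 h2 h3
  rw [h1, h2, h3, neg_sub, sub_eq_add_neg, fourier_add, fourier_neg]
  simp only [RCLike.inner_apply, smul_eq_mul]
  ring

theorem hasSum_inner_fourier_mul (g : C(UnitAddCircle, ℂ)) (f : L2) (n : ℤ) :
    HasSum (fun k : ℤ => ⟪fourierLp (T := 1) 2 k, f⟫_ℂ * fourierCoeff g (n - k))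
      ⟪fourierLp (T := 1) 2 n, mulL2 g f⟫_ℂ := by
  have h := (fourierBasis (T := 1)).hasSum_repr f
  have h' := h.mapL ((innerSL ℂ (fourierLp (T := 1) 2 n)) ∘L mulL2 g)
  refine Eq.mp (congrArg (fun F => HasSum F _) (funext fun k => ?_)) h'
  have := inner_fourier_mul g n k
  simp [HilbertBasis.repr_apply_apply, coe_fourierBasis, this]

theorem circleIntegral_eq_fourierCoeff (a : C(Disc, ℂ)) (n : ℤ) :
    (∮ z in C(0, 1), z ^ (-n - 1) * ext0 a z) =
      2 * Real.pi * Complex.I * fourierCoeff (bdry a) n := by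
  have hpi : (2 * Real.pi : ℝ) ≠ 0 := by positivity
  have h1 : ∀ x : ℝ, fourier (-n) (x : UnitAddCircle) • bdry a (x : UnitAddCircle) =
      (fun θ : ℝ => Complex.exp (θ * Complex.I) ^ (-n) * ext0 a (Complex.exp (θ * Complex.I)))
        (2 * Real.pi * x) := by
    intro x
    have h2 : (fourier 1 (x : UnitAddCircle) : ℂ) =
        Complex.exp (((2 * Real.pi * x : ℝ) : ℂ) * Complex.I) := by
      rw [fourier_coe_apply]
      congr 1
      push_cast
      ring
    have h3 : bdry a (x : UnitAddCircle) =
        ext0 a (Complex.exp (((2 * Real.pi * x : ℝ) : ℂ) * Complex.I)) := by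
      rw [← h2]
      exact (ext0_of_mem a (circ (x : UnitAddCircle)).2).symm
    have h4 : (fourier (-n) (x : UnitAddCircle) : ℂ) =
        Complex.exp (((2 * Real.pi * x : ℝ) : ℂ) * Complex.I) ^ (-n) := by
      rw [fourier_coe_apply, ← Complex.exp_int_mul]
      congr 1
      push_cast
      ring
    simp only [smul_eq_mul, h3, h4]
  rw [fourierCoeff_eq_intervalIntegral _ n 0]
  simp_rw [h1]
  rw [intervalIntegral.integral_comp_mul_left (fun θ : ℝ => Complex.exp (θ * Complex.I) ^ (-n) *
    ext0 a (Complex.exp (θ * Complex.I))) hpi]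
  simp only [circleIntegral, deriv_circleMap, circleMap, smul_eq_mul, zero_add, mul_zero, mul_one,
    Complex.ofReal_one, one_mul, one_div, inv_one, one_smul, Complex.real_smul]
  have h5 : ∀ θ : ℝ, Complex.exp (θ * Complex.I) * Complex.I *
      (Complex.exp (θ * Complex.I) ^ (-n - 1) * ext0 a (Complex.exp (θ * Complex.I))) =
      Complex.I * (Complex.exp (θ * Complex.I) ^ (-n) * ext0 a (Complex.exp (θ * Complex.I))) := by
    intro θ
    rw [zpow_sub_one₀ (Complex.exp_ne_zero _)]
    field_simp [Complex.exp_ne_zero]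
  simp_rw [h5]
  rw [intervalIntegral.integral_const_mul]
  push_cast
  field_simp

theorem diffContOnCl_ext0 {a : C(Disc, ℂ)} (ha : a ∈ discAlgebra) :
    DiffContOnCl ℂ (ext0 a) (ball 0 1) := by
  refine ⟨ha, ?_⟩
  rw [closure_ball _ one_ne_zero, continuousOn_iff_continuous_domRestrict]
  convert a.continuous using 1
  funext z
  exact ext0_of_mem a z.2

/-- The boundary Fourier coefficients of negative index of a function in the disc algebra
vanish. -/
theorem fourierCoeff_bdry_neg {a : C(Disc, ℂ)} (ha : a ∈ discAlgebra) {n : ℤ} (hn : n < 0) :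
    fourierCoeff (bdry a) n = 0 := by
  have h := circleIntegral_eq_fourierCoeff a n
  obtain ⟨k, hk⟩ := Int.eq_ofNat_of_zero_le (a := -n - 1) (by omega)
  have h0 : (∮ z in C(0, 1), z ^ (-n - 1) * ext0 a z) = 0 := by
    refine DiffContOnCl.circleIntegral_eq_zero zero_le_one ?_
    rw [hk]
    simp only [zpow_natCast]
    exact (differentiable_pow k).diffContOnCl.smul (diffContOnCl_ext0 ha)
  rw [h0] at h
  exact (mul_eq_zero.1 h.symm).resolve_left Complex.two_pi_I_ne_zero

/-- The boundary Fourier coefficient of index one of a function in the Neil algebra vanishes. -/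
theorem fourierCoeff_bdry_one {a : C(Disc, ℂ)} (ha : a ∈ neilAlgebra) :
    fourierCoeff (bdry a) 1 = 0 := by
  have h := circleIntegral_eq_fourierCoeff a 1
  have h0 : (∮ z in C(0, 1), z ^ (-1 - 1 : ℤ) * ext0 a z) = 0 := by
    have h1 := (diffContOnCl_ext0 ha.1).deriv_eq_smul_circleIntegral one_pos
    rw [ha.2, smul_zero] at h1
    rw [← h1]
    congr 1
    funext z
    rw [sub_zero, smul_eq_mul, one_div, show (-1 - 1 : ℤ) = -((2 : ℕ) : ℤ) by norm_num,
      zpow_neg, zpow_natCast]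
  rw [h0] at h
  exact (mul_eq_zero.1 h.symm).resolve_left Complex.two_pi_I_ne_zero

/-- `H²_𝒱` is invariant under multiplication by elements of the Neil algebra. -/
theorem mulL2_mem_H2V {V : Submodule ℂ L2} (hV : V ≤ CCz) {a : C(Disc, ℂ)}
    (ha : a ∈ neilAlgebra) {f : L2} (hf : f ∈ H2V V) : mulL2 (bdry a) f ∈ H2V V := by
  have key : ∀ n : ℤ, n ≤ 1 → ⟪fourierLp (T := 1) 2 n, mulL2 (bdry a) f⟫_ℂ =
      ⟪fourierLp (T := 1) 2 n, f⟫_ℂ * fourierCoeff (bdry a) 0 := by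
    intro n hn
    refine (hasSum_inner_fourier_mul (bdry a) f n).unique ?_
    have h1 := hasSum_single (f := fun k : ℤ =>
      ⟪fourierLp (T := 1) 2 k, f⟫_ℂ * fourierCoeff (bdry a) (n - k)) n ?_
    · simpa using h1
    intro k hk
    rcases lt_or_ge k 0 with hk0 | hk0
    · simp only [hf.1 k hk0, zero_mul]
    · rcases lt_or_ge n k with h | h
      · simp only [fourierCoeff_bdry_neg ha.1 (sub_neg.mpr h), mul_zero]
      · obtain rfl : k = 0 := by omega
        obtain rfl : n = 1 := by omega
        simp only [sub_zero, fourierCoeff_bdry_one ha, mul_zero]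
  refine ⟨fun n hn => by rw [key n (by omega), hf.1 n hn, zero_mul], ?_⟩
  refine (Submodule.mem_orthogonal V _).2 fun v hv => ?_
  have h0 := (Submodule.mem_orthogonal V f).1 hf.2 v hv
  obtain ⟨c, d, rfl⟩ := Submodule.mem_span_pair.1 (hV hv)
  simp only [inner_add_left, inner_smul_left, key 0 (by norm_num), key 1 le_rfl] at h0 ⊢
  linear_combination fourierCoeff (bdry a) 0 * h0

theorem mulL2_mul (g g' : C(UnitAddCircle, ℂ)) (f : L2) :
    mulL2 (g * g') f = mulL2 g (mulL2 g' f) := by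
  refine Lp.ext ?_
  filter_upwards [coeFn_mulL2 (g * g') f, coeFn_mulL2 g (mulL2 g' f), coeFn_mulL2 g' f]
    with t h1 h2 h3
  rw [h1, h2, h3, ContinuousMap.mul_apply, mul_assoc]

/-- The representation `π_𝒱(a) f = a f` of the Neil algebra on `H²_𝒱`. -/
def piV (V : Submodule ℂ L2) (hV : V ≤ CCz) : Rep (H2V V) where
  toFun a := (mulL2 (bdry a)).restrict (fun _ hf => mulL2_mem_H2V hV a.2 hf)
  map_smul' c a := by
    ext1 f
    apply Subtype.ext
    change mulL2 (c • bdry (a : C(Disc, ℂ))) f = c • mulL2 (bdry a) f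
    simp [mulL2]
  map_zero' := by
    ext1 f
    apply Subtype.ext
    change mulL2 0 f = 0
    simp [mulL2]
  map_add' a b := by
    ext1 f
    apply Subtype.ext
    change mulL2 (bdry (a : C(Disc, ℂ)) + bdry b) f = mulL2 (bdry a) f + mulL2 (bdry b) f
    simp [mulL2]
  map_mul' a b := by
    ext1 f
    apply Subtype.ext
    exact mulL2_mul (bdry (a : C(Disc, ℂ))) (bdry b) f

end NeilAlg

end

/-!
If `‖1 - ε T‖ ≤ 1 + O(ε²)` as `ε → 0⁺` then `T` has nonnegative real part, so a unital completely
contractive map on the Neil algebra is completely positive with respect to the boundary values on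
the circle. The M. Riesz extension theorem and the Gelfand–Naimark–Segal construction, applied to
kernels on `H × H` with values in `C(𝕋)`, then dilate it to a *-representation `ρ` of `C(𝕋)` on some
`K ⊇ H`, and extremality makes `H` a `ρ(𝒜)`-invariant subspace of `K`.

Let `M` be the largest `z`-invariant subspace of `K` with `z² M ⊆ H`; it contains `H`. If `z M = M`,
then `H` reduces `ρ`, contradicting purity. So there is a unit vector `e ∈ M ⊖ z M`, and `1 ↦ e`
extends to an isometry `J : L² → K` with `J(H²) ⊆ M`. A vector of `M ⊖ J(H²)` and `e` would generate
orthogonal `𝒜`-invariant subspaces of `H` after multiplication by `z²`, so rank one gives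
`M = J(H²)`. Thus `J(z² H²) ⊆ H ⊆ J(H²)`, that is, `H = J(H²_𝒱)` for some `𝒱 ⊆ ℂ ⊕ ℂz`.

Conversely, functions `f`, `g` from orthogonal invariant subspaces of `H²_𝒱` satisfy
`⟨zʲ f, zᵏ g⟩ = 0` for all `j, k ≥ 2`, so all Fourier coefficients of `f̄ g` vanish, `f g = 0`
almost everywhere, and one of `f`, `g` is zero because the power series ring has no zero divisors.
-/

noncomputable section

namespace NeilAlg

open scoped ComplexConjugate

universe w

/-! ### Operators with positive real part -/

section Accretive

variable {E : Type*} [NormedAddCommGroup E] [InnerProductSpace ℂ E]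

theorem norm_sub_smul_sq (x y : E) (ε : ℝ) :
    ‖x - (ε : ℂ) • y‖ ^ 2 = ‖x‖ ^ 2 - 2 * ε * (⟪x, y⟫_ℂ).re + ε ^ 2 * ‖y‖ ^ 2 := by
  rw [@norm_sub_sq ℂ, inner_smul_right, norm_smul]
  simp only [RCLike.re_to_complex, Complex.re_ofReal_mul, Complex.norm_real, Real.norm_eq_abs,
    mul_pow, sq_abs]
  ring

theorem norm_one_sub_smul_le {T : E →L[ℂ] E} {C : ℝ} (hT : ∀ x, 0 ≤ (⟪x, T x⟫_ℂ).re)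
    (hC : ‖T‖ ≤ C) {ε : ℝ} (hε : 0 ≤ ε) : ‖1 - (ε : ℂ) • T‖ ≤ √(1 + ε ^ 2 * C ^ 2) := by
  refine ContinuousLinearMap.opNorm_le_bound _ (Real.sqrt_nonneg _) fun x => ?_
  refine le_of_sq_le_sq ?_ (by positivity)
  have hTx : ‖T x‖ ^ 2 ≤ (C * ‖x‖) ^ 2 := by
    gcongr
    exact T.le_of_opNorm_le hC x
  calc ‖x - (ε : ℂ) • T x‖ ^ 2
      = ‖x‖ ^ 2 - 2 * ε * (⟪x, T x⟫_ℂ).re + ε ^ 2 * ‖T x‖ ^ 2 := norm_sub_smul_sq x (T x) ε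
    _ ≤ ‖x‖ ^ 2 + ε ^ 2 * (C * ‖x‖) ^ 2 := by
      gcongr
      exact sub_le_self _ (mul_nonneg (by positivity) (hT x))
    _ = (√(1 + ε ^ 2 * C ^ 2) * ‖x‖) ^ 2 := by
      rw [mul_pow √_, Real.sq_sqrt (by positivity)]
      ring

theorem re_inner_nonneg_of_norm_one_sub_smul_le {T : E →L[ℂ] E} {C : ℝ}
    (h : ∀ ε : ℝ, 0 < ε → ‖1 - (ε : ℂ) • T‖ ≤ √(1 + ε ^ 2 * C ^ 2)) (x : E) :
    0 ≤ (⟪x, T x⟫_ℂ).re := by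
  have hlower : ∀ ε : ℝ, 0 < ε → -(ε * (C ^ 2 * ‖x‖ ^ 2 / 2)) ≤ (⟪x, T x⟫_ℂ).re := by
    intro ε hε
    have hx : ‖x - (ε : ℂ) • T x‖ ^ 2 ≤ (√(1 + ε ^ 2 * C ^ 2) * ‖x‖) ^ 2 := by
      gcongr
      exact (1 - (ε : ℂ) • T).le_of_opNorm_le (h ε hε) x
    rw [norm_sub_smul_sq, mul_pow √_, Real.sq_sqrt (by positivity)] at hx
    have hTx : 0 ≤ ε ^ 2 * ‖T x‖ ^ 2 := by positivity
    refine le_of_mul_le_mul_left ?_ (show 0 < 2 * ε by positivity)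
    linarith
  have hlim : Filter.Tendsto (fun ε : ℝ => -(ε * (C ^ 2 * ‖x‖ ^ 2 / 2)))
      (nhdsWithin 0 (Set.Ioi 0)) (nhds 0) := by
    have hcont : Continuous fun ε : ℝ => -(ε * (C ^ 2 * ‖x‖ ^ 2 / 2)) := by fun_prop
    simpa using (hcont.tendsto 0).mono_left nhdsWithin_le_nhds
  exact le_of_tendsto hlim (eventually_nhdsWithin_of_forall hlower)

end Accretive

/-! ### Matrices of continuous functions and of operators -/

section Matrices

variable {X : Type w} [TopologicalSpace X] {n : ℕ}

/-- The value at a point of a matrix of functions, as an operator on Euclidean space. -/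
def evalMat (F : Matrix (Fin n) (Fin n) C(X, ℂ)) (x : X) :
    EuclideanSpace ℂ (Fin n) →L[ℂ] EuclideanSpace ℂ (Fin n) :=
  Matrix.toEuclideanCLM (n := Fin n) (𝕜 := ℂ) (F.map (· x))

theorem evalMat_apply (F : Matrix (Fin n) (Fin n) C(X, ℂ)) (x : X)
    (c : EuclideanSpace ℂ (Fin n)) (j : Fin n) : evalMat F x c j = ∑ k, F j k x * c k := by
  simp [evalMat, Matrix.ofLp_toEuclideanCLM, Matrix.mulVec, dotProduct]

theorem inner_evalMat (F : Matrix (Fin n) (Fin n) C(X, ℂ)) (x : X)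
    (c d : EuclideanSpace ℂ (Fin n)) :
    ⟪d, evalMat F x c⟫_ℂ = ∑ j, ∑ k, conj (d j) * c k * F j k x := by
  simp only [PiLp.inner_apply, evalMat_apply, RCLike.inner_apply, Finset.sum_mul]
  exact Finset.sum_congr rfl fun j _ => Finset.sum_congr rfl fun k _ => by ring

theorem continuous_evalMat (F : Matrix (Fin n) (Fin n) C(X, ℂ)) : Continuous (evalMat F) :=
  (LinearMap.continuous_of_finiteDimensional
    (Matrix.toEuclideanCLM (n := Fin n) (𝕜 := ℂ)).toAlgEquiv.toLinearMap).comp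
    (continuous_pi fun j => continuous_pi fun k => (F j k).continuous)

theorem exists_norm_evalMat_le [CompactSpace X] (F : Matrix (Fin n) (Fin n) C(X, ℂ)) :
    ∃ C, 0 ≤ C ∧ ∀ x, ‖evalMat F x‖ ≤ C :=
  ⟨_, norm_nonneg _, ContinuousMap.norm_coe_le_norm ⟨evalMat F, continuous_evalMat F⟩⟩

theorem continuous_toEuclideanCLM_symm_apply (j k : Fin n) :
    Continuous fun T => (Matrix.toEuclideanCLM (n := Fin n) (𝕜 := ℂ)).symm T j k :=
  LinearMap.continuous_of_finiteDimensional (Matrix.entryLinearMap ℂ ℂ j k ∘ₗ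
    (Matrix.toEuclideanCLM (n := Fin n) (𝕜 := ℂ)).symm.toAlgEquiv.toLinearMap)

/-- The matrix of functions with given values, the inverse of `evalMat`. -/
def entries : C(X, EuclideanSpace ℂ (Fin n) →L[ℂ] EuclideanSpace ℂ (Fin n)) →⋆ₐ[ℂ]
    Matrix (Fin n) (Fin n) C(X, ℂ) where
  toFun G := Matrix.of fun j k =>
    ⟨_, (continuous_toEuclideanCLM_symm_apply j k).comp G.continuous⟩
  map_one' := by
    ext j k x
    rcases eq_or_ne j k with rfl | hjk <;> simp [*]
  map_mul' F G := by
    ext j k x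
    simp [Matrix.mul_apply]
  map_zero' := by
    ext j k x
    simp
  map_add' F G := by
    ext j k x
    simp
  commutes' r := by
    ext j k x
    rcases eq_or_ne j k with rfl | hjk <;> simp [Matrix.algebraMap_matrix_apply, *]
  map_star' F := by
    ext j k x
    exact Matrix.ext_iff.2 (Matrix.toEuclideanCLM.symm.map_star' (F x)) j k

theorem entries_evalMat (F : Matrix (Fin n) (Fin n) C(X, ℂ)) :
    entries ⟨evalMat F, continuous_evalMat F⟩ = F := by
  ext j k x
  simp [entries, evalMat]

end Matrices

section BlockOperators

variable {H : Type u} [NormedAddCommGroup H] [InnerProductSpace ℂ H] {n : ℕ}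

/-- Block matrices of operators, as operators on the Hilbert space direct sum. -/
def blockOpHom : Matrix (Fin n) (Fin n) (H →L[ℂ] H) →ₐ[ℂ]
    (PiLp 2 (fun _ : Fin n => H) →L[ℂ] PiLp 2 (fun _ : Fin n => H)) where
  toFun := blockOp
  map_one' := by
    ext x j
    simp [blockOp_apply, Matrix.one_apply, DFunLike.ite_apply]
  map_mul' S T := by
    ext x j
    simp only [blockOp_apply, Matrix.mul_apply, mul_apply_eq_comp, map_sum, sum_apply]
    exact Finset.sum_comm
  map_zero' := by
    ext x j
    simp [blockOp_apply]
  map_add' S T := by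
    ext x j
    simp [blockOp_apply, Finset.sum_add_distrib]
  commutes' r := by
    ext x j
    simp [blockOp_apply, Matrix.algebraMap_matrix_apply, DFunLike.ite_apply]

variable [CompleteSpace H]

theorem star_blockOp (T : Matrix (Fin n) (Fin n) (H →L[ℂ] H)) :
    blockOp (star T) = star (blockOp T) := by
  refine (ContinuousLinearMap.eq_adjoint_iff _ _).2 fun x y => ?_
  simp only [PiLp.inner_apply, blockOp_apply, sum_inner, inner_sum, Matrix.star_apply,
    ContinuousLinearMap.star_eq_adjoint, ContinuousLinearMap.adjoint_inner_left]
  exact Finset.sum_comm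

variable {X : Type w} [TopologicalSpace X]

/-- The representation of the matrices of functions on the direct sum of `n` copies of `H` induced
by a *-representation of the functions on `H`. -/
def matrixRep (ρ : C(X, ℂ) →⋆ₐ[ℂ] (H →L[ℂ] H)) : Matrix (Fin n) (Fin n) C(X, ℂ) →⋆ₐ[ℂ]
    (PiLp 2 (fun _ : Fin n => H) →L[ℂ] PiLp 2 (fun _ : Fin n => H)) :=
  { blockOpHom.comp (ρ : C(X, ℂ) →ₐ[ℂ] (H →L[ℂ] H)).mapMatrix with
    map_star' := fun F => by
      refine Eq.trans (congrArg blockOp ?_) (star_blockOp (F.map ρ))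
      ext j k : 1
      exact map_star ρ (F k j) }

theorem norm_blockOp_map_le [CompactSpace X] (ρ : C(X, ℂ) →⋆ₐ[ℂ] (H →L[ℂ] H))
    (F : Matrix (Fin n) (Fin n) C(X, ℂ)) {m : ℝ} (hm : 0 ≤ m) (hF : ∀ x, ‖evalMat F x‖ ≤ m) :
    ‖blockOp (F.map ρ)‖ ≤ m := by
  have h := NonUnitalStarAlgHom.norm_apply_le ((matrixRep ρ).comp entries)
    ⟨evalMat F, continuous_evalMat F⟩
  rw [StarAlgHom.comp_apply, entries_evalMat] at h
  exact h.trans ((ContinuousMap.norm_le _ hm).2 hF)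

end BlockOperators

/-! ### Positivity and the extension of functionals -/

section Positivity

variable {X : Type w} [TopologicalSpace X]
  {H : Type u} [NormedAddCommGroup H] [InnerProductSpace ℂ H]
  {E : Type*} [AddCommGroup E] [Module ℂ E]
  {β : E →ₗ[ℂ] C(X, ℂ)} {π : E →ₗ[ℂ] (H →L[ℂ] H)}

/-- Complete contractivity of the linear map `π`, the norm of a matrix over `E` being the supremum
over `X` of the norms of its image under `β`. -/
def IsCompletelyContractiveAlong (β : E →ₗ[ℂ] C(X, ℂ)) (π : E →ₗ[ℂ] (H →L[ℂ] H)) : Prop :=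
  ∀ (n : ℕ) (F : Matrix (Fin n) (Fin n) E) (m : ℝ), 0 ≤ m →
    (∀ x, ‖evalMat (F.map β) x‖ ≤ m) → ‖blockOp (F.map π)‖ ≤ m

variable {n : ℕ} {u : E}

theorem evalMat_diagonal_sub_smul (hβ : β u = 1) (ε : ℂ) (F : Matrix (Fin n) (Fin n) E) (x : X) :
    evalMat ((Matrix.diagonal (fun _ => u) - ε • F).map β) x = 1 - ε • evalMat (F.map β) x := by
  have h : ((Matrix.diagonal (fun _ => u) - ε • F).map β).map (· x) =
      1 - ε • (F.map β).map (· x) := by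
    ext j k
    rcases eq_or_ne j k with rfl | hjk <;> simp [*]
  rw [evalMat, h, map_sub, map_one, map_smul, ← evalMat]

theorem blockOp_diagonal_sub_smul (hπ : π u = 1) (ε : ℂ) (F : Matrix (Fin n) (Fin n) E) :
    blockOp ((Matrix.diagonal (fun _ => u) - ε • F).map π) = 1 - ε • blockOp (F.map π) := by
  have h : (Matrix.diagonal (fun _ => u) - ε • F).map π = 1 - ε • F.map π := by
    ext j k : 1
    rcases eq_or_ne j k with rfl | hjk <;> simp [*]
  rw [h]
  exact (map_sub blockOpHom _ _).trans
    (congrArg₂ _ (map_one blockOpHom) (map_smul blockOpHom ε (F.map π)))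

theorem re_inner_blockOp_nonneg [CompactSpace X] (hβ : β u = 1) (hπ : π u = 1)
    (hc : IsCompletelyContractiveAlong β π) {F : Matrix (Fin n) (Fin n) E}
    (hF : ∀ x c, 0 ≤ (⟪c, evalMat (F.map β) x c⟫_ℂ).re) (y : PiLp 2 (fun _ : Fin n => H)) :
    0 ≤ (⟪y, blockOp (F.map π) y⟫_ℂ).re := by
  obtain ⟨C, -, hC⟩ := exists_norm_evalMat_le (F.map β)
  refine re_inner_nonneg_of_norm_one_sub_smul_le (C := C) (fun ε hε => ?_) y
  rw [← blockOp_diagonal_sub_smul hπ]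
  refine hc n _ _ (Real.sqrt_nonneg _) fun x => ?_
  rw [evalMat_diagonal_sub_smul hβ]
  exact norm_one_sub_smul_le (hF x) (hC x) hε.le

end Positivity

theorem exists_nonneg_extension {L W : Type*} [AddCommGroup L] [Module ℂ L] [AddCommGroup W]
    [Module ℂ W] (s : PointedCone ℝ L) (q : W →ₗ[ℂ] L) (f : W →ₗ[ℂ] ℂ)
    (hf : ∀ w, q w ∈ s → 0 ≤ (f w).re) (hq : ∀ y, ∃ w, q w + y ∈ s) :
    ∃ Φ : L →ₗ[ℂ] ℂ, (∀ w, Φ (q w) = f w) ∧ ∀ y ∈ s, 0 ≤ (Φ y).re := by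
  have hker : ∀ w ∈ LinearMap.ker q, f w = 0 := by
    intro w hw
    have hre (c : ℂ) : 0 ≤ (c * f w).re := by
      rw [← smul_eq_mul, ← map_smul]
      refine hf _ ?_
      rw [map_smul, hw, smul_zero]
      exact zero_mem s
    have h1 := hre 1
    have h2 := hre (-1)
    have h3 := hre Complex.I
    have h4 := hre (-Complex.I)
    simp only [one_mul, neg_mul, Complex.neg_re, Complex.I_mul_re] at h1 h2 h3 h4
    apply Complex.ext
    · simp only [Complex.zero_re]; linarith
    · simp only [Complex.zero_im]; linarith
  obtain ⟨φ, hφ⟩ : f ∈ LinearMap.range q.dualMap := by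
    rw [LinearMap.range_dualMap_eq_dualAnnihilator_ker]
    exact (Submodule.mem_dualAnnihilator f).2 hker
  have hφq (w : W) : φ (q w) = f w := LinearMap.congr_fun hφ w
  obtain ⟨g, hg, hgs⟩ := riesz_extension s
    ⟨(LinearMap.range q).restrictScalars ℝ,
      Complex.reLm ∘ₗ φ.restrictScalars ℝ ∘ₗ ((LinearMap.range q).restrictScalars ℝ).subtype⟩
    (by
      rintro ⟨_, w, rfl⟩ hw
      simpa [hφq] using hf w hw)
    (fun y => (hq y).imp' (fun w => ⟨q w, w, rfl⟩) fun _ hw => hw)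
  refine ⟨Module.Dual.extendRCLike g, fun w => ?_, fun y hy => ?_⟩
  · have hgq (w : W) : g (q w) = (f w).re := by
      rw [← hφq]
      exact hg ⟨q w, w, rfl⟩
    have hI : g ((RCLike.I : ℂ) • q w) = -(f w).im := by
      rw [← map_smul, hgq, map_smul]
      simp
    rw [Module.Dual.extendRCLike_apply, hgq, hI]
    apply Complex.ext <;> simp
  · simpa [Module.Dual.extendRCLike_apply] using hgs y hy

/-! ### Operator valued kernels -/

section Kernels

variable {H : Type u}

theorem exists_eq_sum_single {M : Type*} [AddCommMonoid M] (F : H × H →₀ M) :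
    ∃ (n : ℕ) (e : Fin n → H), Function.Injective e ∧
      F = ∑ j, ∑ k, Finsupp.single (e j, e k) (F (e j, e k)) := by
  classical
  let S := F.support.image Prod.fst ∪ F.support.image Prod.snd
  have hS : F.support ⊆ S ×ˢ S := fun p hp => Finset.mem_product.2
    ⟨Finset.mem_union_left _ (Finset.mem_image_of_mem _ hp),
      Finset.mem_union_right _ (Finset.mem_image_of_mem _ hp)⟩
  refine ⟨S.card, fun j => S.equivFin.symm j,
    Subtype.val_injective.comp S.equivFin.symm.injective, ?_⟩
  have hreindex (g : H → H × H →₀ M) : ∑ h ∈ S, g h = ∑ j, g (S.equivFin.symm j) := by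
    rw [← Finset.sum_coe_sort, ← Equiv.sum_comp S.equivFin.symm]
  conv_lhs => rw [← F.sum_single]
  rw [Finsupp.sum_of_support_subset F hS _ (by simp), Finset.sum_product, hreindex]
  exact Finset.sum_congr rfl fun j _ => hreindex _

variable {X : Type w} [TopologicalSpace X]

/-- The quadratic form at the finitely supported part of the vector `c` of the scalar kernel
obtained from a kernel with values in `C(X, ℂ)` by evaluating at `x`. -/
def quad (x : X) (c : H → ℂ) : (H × H →₀ C(X, ℂ)) →ₗ[ℂ] ℂ :=
  Finsupp.lsum ℂ fun p => (conj (c p.1) * c p.2) • (ContinuousMap.evalCLM ℂ x).toLinearMap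

theorem quad_single (x : X) (c : H → ℂ) (p : H × H) (f : C(X, ℂ)) :
    quad x c (Finsupp.single p f) = conj (c p.1) * c p.2 * f x :=
  Finsupp.sum_single_index (by simp)

theorem quad_sum_single (x : X) (c : H → ℂ) {n : ℕ} (e : Fin n → H)
    (G : Matrix (Fin n) (Fin n) C(X, ℂ)) :
    quad x c (∑ j, ∑ k, Finsupp.single (e j, e k) (G j k)) =
      ⟪WithLp.toLp 2 (c ∘ e), evalMat G x (WithLp.toLp 2 (c ∘ e))⟫_ℂ := by
  simp only [inner_evalMat, map_sum, quad_single, Function.comp_apply]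

/-- The cone of kernels whose values have positive semidefinite real part. -/
def posCone (H : Type u) (X : Type w) [TopologicalSpace X] :
    PointedCone ℝ (H × H →₀ C(X, ℂ)) where
  carrier := {F | ∀ x c, 0 ≤ (quad x c F).re}
  add_mem' hF hG x c := by
    rw [map_add, Complex.add_re]
    exact add_nonneg (hF x c) (hG x c)
  zero_mem' x c := by rw [map_zero, Complex.zero_re]
  smul_mem' r F hF x c := by
    have h : quad x c (r • F) = (r : ℝ) • quad x c F :=
      ((quad x c).restrictScalars ℝ).map_smul (r : ℝ) F
    rw [h, Complex.smul_re]
    exact mul_nonneg r.2 (hF x c)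

variable {E : Type*} [AddCommGroup E] [Module ℂ E] {β : E →ₗ[ℂ] C(X, ℂ)}

theorem mapRange_sum_single {n : ℕ} (e : Fin n → H) (G : Matrix (Fin n) (Fin n) E) :
    Finsupp.mapRange.linearMap β (∑ j, ∑ k, Finsupp.single (e j, e k) (G j k)) =
      ∑ j, ∑ k, Finsupp.single (e j, e k) (G.map β j k) := by
  simp only [map_sum, Finsupp.mapRange.linearMap_apply, Finsupp.mapRange_single, Matrix.map_apply]

theorem exists_mapRange_add_mem_posCone [CompactSpace X] {u : E} (hβ : β u = 1)
    (F : H × H →₀ C(X, ℂ)) :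
    ∃ G : H × H →₀ E, Finsupp.mapRange.linearMap β G + F ∈ posCone H X := by
  obtain ⟨n, e, -, hF⟩ := exists_eq_sum_single F
  set A : Matrix (Fin n) (Fin n) C(X, ℂ) := Matrix.of fun j k => F (e j, e k)
  obtain ⟨C, -, hC⟩ := exists_norm_evalMat_le A
  refine ⟨∑ j, Finsupp.single (e j, e j) ((C : ℂ) • u), fun x c => ?_⟩
  set v : EuclideanSpace ℂ (Fin n) := WithLp.toLp 2 (c ∘ e)
  have hdiag : (quad x c (Finsupp.mapRange.linearMap β
      (∑ j, Finsupp.single (e j, e j) ((C : ℂ) • u)))).re = ‖v‖ * (C * ‖v‖) := by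
    simp only [map_sum, Finsupp.mapRange.linearMap_apply, Finsupp.mapRange_single, quad_single,
      map_smul, hβ, Complex.conj_mul', ContinuousMap.smul_apply, ContinuousMap.one_apply,
      smul_eq_mul, mul_one, ← Complex.ofReal_pow, ← Complex.ofReal_mul, ← Complex.ofReal_sum,
      Complex.ofReal_re]
    rw [← Finset.sum_mul, show ‖v‖ * (C * ‖v‖) = ‖v‖ ^ 2 * C by ring,
      EuclideanSpace.norm_sq_eq]
    rfl
  have hquad : -(‖v‖ * (C * ‖v‖)) ≤ (quad x c F).re := by
    rw [hF]
    refine (abs_le.1 ?_).1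
    rw [show quad x c (∑ j, ∑ k, Finsupp.single (e j, e k) (F (e j, e k))) =
      ⟪v, evalMat A x v⟫_ℂ from quad_sum_single x c e A]
    exact (Complex.abs_re_le_norm _).trans ((norm_inner_le_norm v _).trans
      (mul_le_mul_of_nonneg_left ((evalMat A x).le_of_opNorm_le (hC x) v) (norm_nonneg v)))
  rw [map_add, Complex.add_re, hdiag]
  linarith

variable [NormedAddCommGroup H] [InnerProductSpace ℂ H] {π : E →ₗ[ℂ] (H →L[ℂ] H)}

/-- The functional `F ↦ ∑ ⟪h, π (F (h, k)) k⟫` on kernels. -/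
def kernelForm (π : E →ₗ[ℂ] (H →L[ℂ] H)) : (H × H →₀ E) →ₗ[ℂ] ℂ :=
  Finsupp.lsum ℂ fun p => (innerSL ℂ p.1).toLinearMap ∘ₗ
    (ContinuousLinearMap.apply ℂ H p.2).toLinearMap ∘ₗ π

theorem kernelForm_single (p : H × H) (a : E) :
    kernelForm π (Finsupp.single p a) = ⟪p.1, π a p.2⟫_ℂ :=
  Finsupp.sum_single_index (by simp)

theorem kernelForm_sum_single {n : ℕ} (e : Fin n → H) (G : Matrix (Fin n) (Fin n) E) :
    kernelForm π (∑ j, ∑ k, Finsupp.single (e j, e k) (G j k)) =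
      ⟪WithLp.toLp 2 e, blockOp (G.map π) (WithLp.toLp 2 e)⟫_ℂ := by
  simp only [map_sum, kernelForm_single, PiLp.inner_apply, blockOp_apply, inner_sum,
    Matrix.map_apply]

theorem re_kernelForm_nonneg [CompactSpace X] {u : E} (hβ : β u = 1) (hπ : π u = 1)
    (hc : IsCompletelyContractiveAlong β π) (F : H × H →₀ E)
    (hF : Finsupp.mapRange.linearMap β F ∈ posCone H X) : 0 ≤ (kernelForm π F).re := by
  obtain ⟨n, e, he, hFe⟩ := exists_eq_sum_single F
  set G : Matrix (Fin n) (Fin n) E := Matrix.of fun j k => F (e j, e k)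
  replace hFe : F = ∑ j, ∑ k, Finsupp.single (e j, e k) (G j k) := hFe
  rw [hFe, kernelForm_sum_single]
  refine re_inner_blockOp_nonneg hβ hπ hc (fun x c => ?_) _
  have h := hF x (Function.extend e c 0)
  rwa [hFe, mapRange_sum_single, quad_sum_single, Function.extend_comp he] at h

theorem exists_nonneg_functional [CompactSpace X] {u : E} (hβ : β u = 1) (hπ : π u = 1)
    (hc : IsCompletelyContractiveAlong β π) :
    ∃ Φ : (H × H →₀ C(X, ℂ)) →ₗ[ℂ] ℂ, (∀ F ∈ posCone H X, 0 ≤ (Φ F).re) ∧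
      ∀ (p : H × H) (a : E), Φ (Finsupp.single p (β a)) = ⟪p.1, π a p.2⟫_ℂ := by
  obtain ⟨Φ, hΦ, hpos⟩ := exists_nonneg_extension (posCone H X) (Finsupp.mapRange.linearMap β)
    (kernelForm π) (re_kernelForm_nonneg hβ hπ hc) (exists_mapRange_add_mem_posCone hβ)
  refine ⟨Φ, hpos, fun p a => ?_⟩
  rw [← kernelForm_single, ← hΦ, Finsupp.mapRange.linearMap_apply, Finsupp.mapRange_single]

end Kernels

/-! ### The dilation theorem -/

theorem exists_hilbert_of_core {Y : Type u} [AddCommGroup Y] [Module ℂ Y]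
    (c : PreInnerProductSpace.Core ℂ Y) :
    ∃ (K : Type u) (_ : NormedAddCommGroup K) (_ : InnerProductSpace ℂ K) (_ : CompleteSpace K)
      (ι : Y →ₗ[ℂ] K), DenseRange ι ∧ ∀ x y, ⟪ι x, ι y⟫_ℂ = c.inner x y := by
  let : SeminormedAddCommGroup Y := @InnerProductSpace.Core.toSeminormedAddCommGroup ℂ Y _ _ _ c
  let : InnerProductSpace ℂ Y := InnerProductSpace.ofCore c
  exact ⟨UniformSpace.Completion Y, inferInstance, inferInstance, inferInstance,
    (UniformSpace.Completion.toComplₗᵢ (𝕜 := ℂ) (E := Y)).toLinearMap,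
    UniformSpace.Completion.denseRange_coe, UniformSpace.Completion.inner_coe⟩

theorem exists_linearIsometry_of_inner {E F : Type*} [NormedAddCommGroup E]
    [InnerProductSpace ℂ E] [NormedAddCommGroup F] [InnerProductSpace ℂ F] (f : E → F)
    (hf : ∀ x y, ⟪f x, f y⟫_ℂ = ⟪x, y⟫_ℂ) : ∃ V : E →ₗᵢ[ℂ] F, ∀ x, V x = f x := by
  have hadd (x y : E) : f (x + y) = f x + f y := by
    rw [← sub_eq_zero, ← inner_self_eq_zero (𝕜 := ℂ)]
    simp only [inner_sub_left, inner_sub_right, inner_add_left, inner_add_right, hf]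
    ring
  have hsmul (r : ℂ) (x : E) : f (r • x) = r • f x := by
    rw [← sub_eq_zero, ← inner_self_eq_zero (𝕜 := ℂ)]
    simp only [inner_sub_left, inner_sub_right, inner_smul_left, inner_smul_right, hf]
    ring
  exact ⟨LinearMap.isometryOfInner { toFun := f, map_add' := hadd, map_smul' := hsmul } hf,
    fun _ => rfl⟩

section Dilation

variable {H : Type u} {X : Type w} [TopologicalSpace X]

/-- The kernel `(h, k) ↦ star (x h) * y k` of two finitely supported functions on `H`. -/
def rankOneKernel (x y : H →₀ C(X, ℂ)) : H × H →₀ C(X, ℂ) :=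
  Finsupp.onFinset (x.support ×ˢ y.support) (fun p => star (x p.1) * y p.2) fun p hp => by
    rw [Finset.mem_product, Finsupp.mem_support_iff, Finsupp.mem_support_iff]
    refine ⟨fun h => hp ?_, fun h => hp ?_⟩ <;> simp [h]

theorem rankOneKernel_apply (x y : H →₀ C(X, ℂ)) (p : H × H) :
    rankOneKernel x y p = star (x p.1) * y p.2 := rfl

theorem rankOneKernel_star_smul (f : C(X, ℂ)) (x y : H →₀ C(X, ℂ)) :
    rankOneKernel (star f • x) y = rankOneKernel x (f • y) := by
  ext1 p
  simp only [rankOneKernel_apply, Finsupp.smul_apply, smul_eq_mul, star_mul, star_star]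
  ring

theorem rankOneKernel_single (h k : H) (f : C(X, ℂ)) :
    rankOneKernel (Finsupp.single h 1) (Finsupp.single k f) = Finsupp.single (h, k) f := by
  classical
  ext1 p
  rw [rankOneKernel_apply, Finsupp.single_apply, Finsupp.single_apply, Finsupp.single_apply]
  rcases eq_or_ne h p.1 with h1 | h1 <;> rcases eq_or_ne k p.2 with h2 | h2 <;>
    simp [h1, h2, Prod.ext_iff]

/-- The functional `∑ c h • x h` of a finitely supported function, evaluated at a point. -/
def evalVec (z : X) (c : H → ℂ) : (H →₀ C(X, ℂ)) →ₗ[ℂ] ℂ :=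
  Finsupp.lsum ℂ fun h => c h • (ContinuousMap.evalCLM ℂ z).toLinearMap

theorem evalVec_apply (z : X) (c : H → ℂ) (x : H →₀ C(X, ℂ)) :
    evalVec z c x = x.sum fun h f => c h * f z := rfl

theorem evalVec_smul (z : X) (c : H → ℂ) (f : C(X, ℂ)) (x : H →₀ C(X, ℂ)) :
    evalVec z c (f • x) = f z * evalVec z c x := by
  rw [evalVec_apply, Finsupp.sum_smul_index (by simp), evalVec_apply, Finsupp.mul_sum]
  refine Finsupp.sum_congr fun h _ => ?_
  rw [ContinuousMap.mul_apply]
  ring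

theorem quad_rankOneKernel (z : X) (c : H → ℂ) (x y : H →₀ C(X, ℂ)) :
    quad z c (rankOneKernel x y) = conj (evalVec z c x) * evalVec z c y := by
  change (rankOneKernel x y).sum (fun p f => conj (c p.1) * c p.2 * f z) = _
  rw [Finsupp.sum_of_support_subset (rankOneKernel x y) (s := x.support ×ˢ y.support)
    Finsupp.support_onFinset_subset _ (by simp), Finset.sum_product, evalVec_apply, evalVec_apply,
    Finsupp.sum, Finsupp.sum, map_sum, Finset.sum_mul_sum]
  refine Finset.sum_congr rfl fun h _ => Finset.sum_congr rfl fun k _ => ?_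
  rw [rankOneKernel_apply, ContinuousMap.mul_apply, ContinuousMap.star_apply, map_mul,
    RCLike.star_def]
  ring

variable {Φ : (H × H →₀ C(X, ℂ)) →ₗ[ℂ] ℂ}

theorem re_eq_zero_of_re_quad_eq_zero (hΦ : ∀ F ∈ posCone H X, 0 ≤ (Φ F).re)
    {F : H × H →₀ C(X, ℂ)} (hF : ∀ z c, (quad z c F).re = 0) : (Φ F).re = 0 := by
  refine le_antisymm ?_ (hΦ F fun z c => (hF z c).ge)
  have h := hΦ ((-1 : ℂ) • F) fun z c => by
    rw [map_smul, neg_one_smul, Complex.neg_re, hF z c, neg_zero]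
  rwa [map_smul, neg_one_smul, Complex.neg_re, neg_nonneg] at h

theorem conj_map_rankOneKernel (hΦ : ∀ F ∈ posCone H X, 0 ≤ (Φ F).re) (x y : H →₀ C(X, ℂ)) :
    conj (Φ (rankOneKernel y x)) = Φ (rankOneKernel x y) := by
  have hre := re_eq_zero_of_re_quad_eq_zero hΦ
    (F := rankOneKernel x y + (-1 : ℂ) • rankOneKernel y x) fun z c => by
      rw [map_add, map_smul, quad_rankOneKernel, quad_rankOneKernel, neg_one_smul, Complex.add_re,
        Complex.neg_re, Complex.mul_re, Complex.mul_re]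
      simp only [Complex.conj_re, Complex.conj_im]
      ring
  have him := re_eq_zero_of_re_quad_eq_zero hΦ
    (F := Complex.I • (rankOneKernel x y + rankOneKernel y x)) fun z c => by
      rw [map_smul, map_add, quad_rankOneKernel, quad_rankOneKernel, smul_eq_mul,
        Complex.I_mul_re, Complex.add_im, Complex.mul_im, Complex.mul_im]
      simp only [Complex.conj_re, Complex.conj_im]
      ring
  rw [map_add, map_smul, neg_one_smul, Complex.add_re, Complex.neg_re] at hre
  rw [map_smul, map_add, smul_eq_mul, Complex.I_mul_re, Complex.add_im] at him
  apply Complex.ext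
  · rw [Complex.conj_re]; linarith
  · rw [Complex.conj_im]; linarith

/-- The semi-inner product on the finitely supported functions given by a positive functional on
kernels. -/
abbrev kernelCore (hΦ : ∀ F ∈ posCone H X, 0 ≤ (Φ F).re) :
    PreInnerProductSpace.Core ℂ (H →₀ C(X, ℂ)) where
  inner x y := Φ (rankOneKernel x y)
  conj_inner_symm := conj_map_rankOneKernel hΦ
  re_inner_nonneg x := hΦ _ fun z c => by
    rw [quad_rankOneKernel, Complex.conj_mul']
    norm_cast
    positivity
  add_left x y w := by
    rw [← map_add]
    congr 1
    ext1 p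
    simp only [rankOneKernel_apply, Finsupp.add_apply, star_add, add_mul]
  smul_left x y r := by
    rw [← smul_eq_mul, ← map_smul]
    congr 1
    ext1 p
    simp only [rankOneKernel_apply, Finsupp.smul_apply, star_smul, smul_mul_assoc]
    rfl

variable {K : Type v} [NormedAddCommGroup K] [InnerProductSpace ℂ K] {ι : (H →₀ C(X, ℂ)) →ₗ[ℂ] K}

theorem norm_sq_eq_re_rankOneKernel (hι : ∀ x y, ⟪ι x, ι y⟫_ℂ = Φ (rankOneKernel x y))
    (x : H →₀ C(X, ℂ)) : ‖ι x‖ ^ 2 = (Φ (rankOneKernel x x)).re := by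
  rw [← hι, ← inner_self_eq_norm_sq (𝕜 := ℂ), RCLike.re_to_complex]

variable [CompactSpace X]

theorem norm_map_smul_le (hΦ : ∀ F ∈ posCone H X, 0 ≤ (Φ F).re)
    (hι : ∀ x y, ⟪ι x, ι y⟫_ℂ = Φ (rankOneKernel x y)) (f : C(X, ℂ)) (x : H →₀ C(X, ℂ)) :
    ‖ι (f • x)‖ ≤ ‖f‖ * ‖ι x‖ := by
  refine le_of_sq_le_sq ?_ (by positivity)
  have h := hΦ (((‖f‖ ^ 2 : ℝ) : ℂ) • rankOneKernel x x - rankOneKernel (f • x) (f • x))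
    fun z c => by
      simp only [map_sub, map_smul, quad_rankOneKernel, evalVec_smul, Complex.conj_mul', norm_mul,
        smul_eq_mul, ← Complex.ofReal_pow, ← Complex.ofReal_mul, ← Complex.ofReal_sub,
        Complex.ofReal_re, mul_pow, sub_nonneg]
      gcongr
      exact f.norm_coe_le_norm z
  rw [map_sub, map_smul, Complex.sub_re, smul_eq_mul, Complex.re_ofReal_mul,
    ← norm_sq_eq_re_rankOneKernel hι, ← norm_sq_eq_re_rankOneKernel hι] at h
  linarith [mul_pow ‖f‖ ‖ι x‖ 2]

theorem exists_starAlgHom [CompleteSpace K] (hΦ : ∀ F ∈ posCone H X, 0 ≤ (Φ F).re)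
    (hι : ∀ x y, ⟪ι x, ι y⟫_ℂ = Φ (rankOneKernel x y)) (hd : DenseRange ι) :
    ∃ ρ : C(X, ℂ) →⋆ₐ[ℂ] (K →L[ℂ] K), ∀ f x, ρ f (ι x) = ι (f • x) := by
  let R (f : C(X, ℂ)) : K →L[ℂ] K :=
    (ι ∘ₗ DistribSMul.toLinearMap ℂ (H →₀ C(X, ℂ)) f).extendOfNorm ι
  have hRι (f : C(X, ℂ)) (x : H →₀ C(X, ℂ)) : R f (ι x) = ι (f • x) :=
    LinearMap.extendOfNorm_eq hd ⟨‖f‖, norm_map_smul_le hΦ hι f⟩ x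
  have hext (A B : K →L[ℂ] K) (h : ∀ x, A (ι x) = B (ι x)) : A = B :=
    DFunLike.coe_injective (hd.equalizer A.continuous B.continuous (funext h))
  have hmul (f g : C(X, ℂ)) : R (f * g) = R f * R g := hext _ _ fun x => by
    rw [hRι, mul_smul, mul_apply_eq_comp, hRι, hRι]
  have hadd (f g : C(X, ℂ)) : R (f + g) = R f + R g := hext _ _ fun x => by
    rw [hRι, add_smul, map_add, add_apply, hRι, hRι]
  have hscalar (r : ℂ) : R (algebraMap ℂ _ r) = algebraMap ℂ _ r := hext _ _ fun x => by
    rw [hRι, Algebra.algebraMap_eq_smul_one, Algebra.algebraMap_eq_smul_one, smul_assoc, one_smul,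
      map_smul, smul_apply, one_apply_eq_self]
  have hstar (f : C(X, ℂ)) : R (star f) = star (R f) := by
    refine (ContinuousLinearMap.eq_adjoint_iff _ _).2 fun x y => ?_
    refine hd.induction_on₂ (p := fun x y => ⟪R (star f) x, y⟫_ℂ = ⟪x, R f y⟫_ℂ)
      (isClosed_eq (by fun_prop) (by fun_prop)) (fun a b => ?_) x y
    rw [hRι, hRι, hι, hι, rankOneKernel_star_smul]
  exact ⟨{
    toFun := R
    map_one' := by simpa only [map_one] using hscalar 1
    map_mul' := hmul
    map_zero' := by simpa only [map_zero] using hscalar 0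
    map_add' := hadd
    commutes' := hscalar
    map_star' := hstar }, hRι⟩

theorem exists_dilation [NormedAddCommGroup H] [InnerProductSpace ℂ H] {E : Type*}
    [AddCommGroup E] [Module ℂ E] {β : E →ₗ[ℂ] C(X, ℂ)} {π : E →ₗ[ℂ] (H →L[ℂ] H)} {u : E}
    (hβ : β u = 1) (hπ : π u = 1) (hc : IsCompletelyContractiveAlong β π) :
    ∃ (K : Type (max u w)) (_ : NormedAddCommGroup K) (_ : InnerProductSpace ℂ K)
      (_ : CompleteSpace K) (ρ : C(X, ℂ) →⋆ₐ[ℂ] (K →L[ℂ] K)) (V : H →ₗᵢ[ℂ] K),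
      ∀ a h k, ⟪V h, ρ (β a) (V k)⟫_ℂ = ⟪h, π a k⟫_ℂ := by
  obtain ⟨Φ, hΦ, hΦπ⟩ := exists_nonneg_functional hβ hπ hc
  obtain ⟨K, _, _, _, ι, hd, hι⟩ := exists_hilbert_of_core (kernelCore hΦ)
  obtain ⟨ρ, hρ⟩ := exists_starAlgHom hΦ hι hd
  have hinner (a : E) (h k : H) :
      ⟪ι (Finsupp.single h 1), ρ (β a) (ι (Finsupp.single k 1))⟫_ℂ = ⟪h, π a k⟫_ℂ := by
    rw [hρ, Finsupp.smul_single, smul_eq_mul, mul_one, hι]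
    exact (congrArg Φ (rankOneKernel_single h k (β a))).trans (hΦπ (h, k) a)
  obtain ⟨V, hV⟩ := exists_linearIsometry_of_inner (fun h => ι (Finsupp.single h 1)) fun h k => by
    simpa only [hβ, hπ, map_one, one_apply_eq_self] using hinner u h k
  refine ⟨K, inferInstance, inferInstance, inferInstance, ρ, V, fun a h k => ?_⟩
  rw [hV, hV, hinner]

end Dilation

/-! ### The Neil algebra on the circle -/

section Boundary

/-- The coordinate function `z` on the closed disc. -/
def coord : C(Disc, ℂ) := ⟨Subtype.val, continuous_subtype_val⟩

theorem coord_pow_mem {m : ℕ} (hm : m ≠ 1) : coord ^ m ∈ neilAlgebra := by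
  have h : Set.EqOn (ext0 (coord ^ m)) (fun z => z ^ m) (ball 0 1) := fun z hz =>
    ext0_of_mem _ (ball_subset_closedBall hz)
  refine ⟨(differentiable_pow m).differentiableOn.congr h, ?_⟩
  rw [(h.eventuallyEq_of_mem (ball_mem_nhds 0 one_pos)).deriv_eq]
  rcases m with _ | _ | m
  · simp
  · exact absurd rfl hm
  · simp

/-- The monomial `z ^ m`, `m ≠ 1`, as an element of the Neil algebra. -/
def monomial (m : ℕ) (hm : m ≠ 1) : neilAlgebra := ⟨coord ^ m, coord_pow_mem hm⟩

theorem bdry_monomial (m : ℕ) (hm : m ≠ 1) :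
    bdry (monomial m hm : C(Disc, ℂ)) = fourier (m : ℤ) := by
  ext t
  change (fourier 1 t : ℂ) ^ m = fourier (m : ℤ) t
  rw [fourier_one, fourier_apply, natCast_zsmul, toCircle_nsmul, Circle.coe_pow]

/-- Restriction of the Neil algebra to the circle. -/
def bdryHom : neilAlgebra →ₐ[ℂ] C(UnitAddCircle, ℂ) :=
  (ContinuousMap.compRightAlgHom ℂ ℂ circ).comp neilAlgebra.val

theorem exists_circ_eq {z : Disc} (hz : ‖(z : ℂ)‖ = 1) : ∃ t, circ t = z := by
  obtain ⟨t, ht⟩ := (homeomorphCircle (T := 1) one_ne_zero).surjective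
    ⟨z, mem_sphere_zero_iff_norm.2 hz⟩
  refine ⟨t, Subtype.ext ?_⟩
  change (fourier 1 t : ℂ) = z
  rw [fourier_one, ← homeomorphCircle_apply one_ne_zero, ht]

theorem IsInner.star_bdry_mul_bdry {a : neilAlgebra} (ha : IsInner a) :
    star (bdry a) * bdry a = 1 := by
  ext t
  have h : ‖bdry a t‖ = 1 := ha (circ t) (by simp [circ, Circle.norm_coe])
  rw [ContinuousMap.mul_apply, ContinuousMap.star_apply, RCLike.star_def, Complex.conj_mul', h]
  simp

variable {n : ℕ} (F : Matrix (Fin n) (Fin n) neilAlgebra)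

theorem norm_evalMat_le_matNorm (z : Disc) :
    ‖evalMat (F.map Subtype.val) z‖ ≤ matNorm F := by
  obtain ⟨C, -, hC⟩ := exists_norm_evalMat_le (F.map Subtype.val)
  have hdense : Dense {w : Disc | (w : ℂ) ∈ ball (0 : ℂ) 1} := by
    rw [Subtype.dense_iff]
    intro w hw
    rw [← closure_ball (0 : ℂ) one_ne_zero] at hw
    refine closure_mono (fun x hx => ?_) hw
    exact ⟨⟨x, ball_subset_closedBall hx⟩, hx, rfl⟩
  refine hdense.induction (P := fun z => ‖evalMat (F.map Subtype.val) z‖ ≤ matNorm F)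
    (fun w hw => ?_) (isClosed_le (continuous_evalMat _).norm continuous_const) z
  exact le_ciSup (f := fun z : ball (0 : ℂ) 1 =>
    ‖evalMat (F.map Subtype.val) ⟨z, ball_subset_closedBall z.2⟩‖)
    ⟨C, Set.forall_mem_range.2 fun z => hC _⟩ ⟨w, hw⟩

theorem norm_apply_le_of_norm_bdry_le {f : C(Disc, ℂ)} (hf : f ∈ discAlgebra) {C : ℝ}
    (hC : ∀ t, ‖bdry f t‖ ≤ C) (z : Disc) : ‖f z‖ ≤ C := by
  rw [← ext0_of_mem f z.2]
  refine Complex.norm_le_of_forall_mem_frontier_norm_le isBounded_ball (diffContOnCl_ext0 hf)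
    (fun w hw => ?_) (by rw [closure_ball _ one_ne_zero]; exact z.2)
  rw [frontier_ball _ one_ne_zero] at hw
  obtain ⟨t, ht⟩ := exists_circ_eq (z := ⟨w, sphere_subset_closedBall hw⟩)
    (mem_sphere_zero_iff_norm.1 hw)
  rw [ext0_of_mem f (sphere_subset_closedBall hw), ← ht]
  exact hC t

theorem matNorm_le {m : ℝ} (hm : 0 ≤ m) (hF : ∀ t, ‖evalMat (F.map bdryHom) t‖ ≤ m) :
    matNorm F ≤ m := by
  have : Nonempty (ball (0 : ℂ) 1) := ⟨0, mem_ball_self one_pos⟩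
  refine ciSup_le fun z => ?_
  change ‖evalMat (F.map Subtype.val) ⟨z, ball_subset_closedBall z.2⟩‖ ≤ m
  refine ContinuousLinearMap.opNorm_le_of_re_inner_le hm fun c d hc hd => ?_
  let g : neilAlgebra := ∑ j, ∑ k, (conj (d j) * c k) • F j k
  have hg (w : Disc) : (g : C(Disc, ℂ)) w = ⟪d, evalMat (F.map Subtype.val) w c⟫_ℂ := by
    simp [g, inner_evalMat]
  have hbdry (t : UnitAddCircle) : ‖bdry g t‖ ≤ m := calc
    ‖bdry g t‖ = ‖⟪d, evalMat (F.map bdryHom) t c⟫_ℂ‖ := congrArg _ (hg (circ t))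
    _ ≤ ‖d‖ * ‖evalMat (F.map bdryHom) t c‖ := norm_inner_le_norm _ _
    _ ≤ m := by simpa [hc, hd] using (evalMat (F.map bdryHom) t).le_of_opNorm_le (hF t) c
  rw [inner_re_symm, ← hg]
  exact (RCLike.re_le_norm _).trans (norm_apply_le_of_norm_bdry_le g.2.1 hbdry _)

end Boundary

section Extension

variable {H : Type u} [NormedAddCommGroup H] [InnerProductSpace ℂ H]

theorem IsCompletelyContractive.along {π : Rep H} (hc : IsCompletelyContractive π) :
    IsCompletelyContractiveAlong bdryHom.toLinearMap (π : neilAlgebra →ₗ[ℂ] (H →L[ℂ] H)) :=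
  fun n F _ hm hF => (hc n F).trans (matNorm_le F hm hF)

/-- The representation of the Neil algebra obtained by restricting a *-representation of the
continuous functions on the circle. -/
def restrictRep [CompleteSpace H] (ρ : C(UnitAddCircle, ℂ) →⋆ₐ[ℂ] (H →L[ℂ] H)) : Rep H :=
  ((ρ : C(UnitAddCircle, ℂ) →ₐ[ℂ] (H →L[ℂ] H)).comp bdryHom : neilAlgebra →ₐ[ℂ] (H →L[ℂ] H))

theorem isCompletelyContractive_restrictRep [CompleteSpace H]
    (ρ : C(UnitAddCircle, ℂ) →⋆ₐ[ℂ] (H →L[ℂ] H)) : IsCompletelyContractive (restrictRep ρ) :=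
  fun _ F => norm_blockOp_map_le ρ (F.map bdryHom) (Real.iSup_nonneg fun _ => norm_nonneg _)
    fun t => norm_evalMat_le_matNorm F (circ t)

variable [CompleteSpace H]

theorem IsExtremal.exists_extension {π : Rep H} (he : IsExtremal π) (hu : IsUnital π)
    (hc : IsCompletelyContractive π) :
    ∃ (K : Type u) (_ : NormedAddCommGroup K) (_ : InnerProductSpace ℂ K) (_ : CompleteSpace K)
      (ρ : C(UnitAddCircle, ℂ) →⋆ₐ[ℂ] (K →L[ℂ] K)) (V : H →ₗᵢ[ℂ] K),
      ∀ (a : neilAlgebra) h, V (π a h) = ρ (bdry a) (V h) := by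
  obtain ⟨K, _, _, _, ρ, V, hV⟩ := exists_dilation
    (β := bdryHom.toLinearMap) (π := (π : neilAlgebra →ₗ[ℂ] (H →L[ℂ] H)))
    (map_one bdryHom) hu hc.along
  refine ⟨K, inferInstance, inferInstance, inferInstance, ρ, V, fun a h => ?_⟩
  refine DFunLike.congr_fun (he K (restrictRep ρ) V (isCompletelyContractive_restrictRep ρ)
    (fun b => ?_) a) h
  ext1 k
  refine ext_inner_left ℂ fun l => ?_
  refine (hV b l k).symm.trans ?_
  exact (ContinuousLinearMap.adjoint_inner_right V.toContinuousLinearMap l (ρ (bdry b) (V k))).symm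

end Extension

/-! ### Representations of the continuous functions on the circle -/

section CircleRep

variable {K : Type v} [NormedAddCommGroup K] [InnerProductSpace ℂ K] [CompleteSpace K]
  (ρ : C(UnitAddCircle, ℂ) →⋆ₐ[ℂ] (K →L[ℂ] K))

/-- The map `f ↦ ρ(f) x`. -/
def orbitMap (x : K) : C(UnitAddCircle, ℂ) →L[ℂ] K where
  toLinearMap := (ContinuousLinearMap.apply ℂ K x).toLinearMap ∘ₗ (ρ : _ →ₗ[ℂ] (K →L[ℂ] K))
  cont := (ContinuousLinearMap.apply ℂ K x).continuous.comp <|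
    AddMonoidHomClass.continuous_of_bound ρ 1 fun f => by
      rw [one_mul]
      exact NonUnitalStarAlgHom.norm_apply_le ρ f

theorem starAlgHom_mul_apply (f g : C(UnitAddCircle, ℂ)) (x : K) :
    ρ (f * g) x = ρ f (ρ g x) := by
  rw [map_mul, mul_apply_eq_comp]

theorem inner_starAlgHom_left (f : C(UnitAddCircle, ℂ)) (x y : K) :
    ⟪ρ f x, y⟫_ℂ = ⟪x, ρ (star f) y⟫_ℂ := by
  rw [map_star, ContinuousLinearMap.star_eq_adjoint, ContinuousLinearMap.adjoint_inner_right]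

theorem starAlgHom_fourier_zero (x : K) : ρ (fourier 0) x = x := by
  have h : (fourier 0 : C(UnitAddCircle, ℂ)) = 1 := ContinuousMap.ext fun _ => fourier_zero
  rw [h, map_one, one_apply_eq_self]

theorem starAlgHom_fourier_add (m n : ℤ) (x : K) :
    ρ (fourier (m + n)) x = ρ (fourier m) (ρ (fourier n) x) := by
  rw [← starAlgHom_mul_apply]
  congr 2
  exact ContinuousMap.ext fun _ => fourier_add

theorem star_fourier (n : ℤ) : star (fourier n : C(UnitAddCircle, ℂ)) = fourier (-n) :=
  ContinuousMap.ext fun _ => fourier_neg.symm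

theorem inner_starAlgHom_fourier_left (n : ℤ) (x y : K) :
    ⟪ρ (fourier n) x, y⟫_ℂ = ⟪x, ρ (fourier (-n)) y⟫_ℂ := by
  rw [inner_starAlgHom_left, star_fourier]

theorem inner_starAlgHom_fourier_fourier (m n : ℤ) (x y : K) :
    ⟪ρ (fourier m) x, ρ (fourier n) y⟫_ℂ = ⟪x, ρ (fourier (n - m)) y⟫_ℂ := by
  rw [inner_starAlgHom_fourier_left, ← starAlgHom_fourier_add, neg_add_eq_sub]

theorem norm_starAlgHom_fourier (n : ℤ) (x : K) : ‖ρ (fourier n) x‖ = ‖x‖ := by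
  refine (sq_eq_sq₀ (norm_nonneg _) (norm_nonneg _)).1 ?_
  rw [← inner_self_eq_norm_sq (𝕜 := ℂ), ← inner_self_eq_norm_sq (𝕜 := ℂ),
    inner_starAlgHom_fourier_fourier, sub_self, starAlgHom_fourier_zero]

variable {ρ}

theorem starAlgHom_mem_of_fourier_mem {P : Submodule ℂ K} (hP : IsClosed (P : Set K)) {x : K}
    (hx : ∀ n : ℤ, ρ (fourier n) x ∈ P) (f : C(UnitAddCircle, ℂ)) : ρ f x ∈ P := by
  have hle : (Submodule.span ℂ (Set.range (fourier (T := 1)))).topologicalClosure ≤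
      P.comap (orbitMap ρ x).toLinearMap :=
    Submodule.topologicalClosure_minimal _ (Submodule.span_le.2 (Set.range_subset_iff.2 hx))
      (hP.preimage (orbitMap ρ x).continuous)
  rw [span_fourier_closure_eq_top] at hle
  exact hle (Submodule.mem_top (x := f))

theorem inner_starAlgHom_eq_zero {x y : K} (h : ∀ n : ℤ, ⟪ρ (fourier n) x, y⟫_ℂ = 0)
    (f : C(UnitAddCircle, ℂ)) : ⟪ρ f x, y⟫_ℂ = 0 := by
  rw [← Submodule.mem_orthogonal_singleton_iff_inner_left]
  exact starAlgHom_mem_of_fourier_mem (Submodule.isClosed_orthogonal _)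
    (fun n => Submodule.mem_orthogonal_singleton_iff_inner_left.2 (h n)) f

theorem starAlgHom_intertwine {L : Type*} [NormedAddCommGroup L] [InnerProductSpace ℂ L]
    [CompleteSpace L] {σ : C(UnitAddCircle, ℂ) →⋆ₐ[ℂ] (L →L[ℂ] L)} (T : L →L[ℂ] K)
    (hT : ∀ (n : ℤ) g, ρ (fourier n) (T g) = T (σ (fourier n) g)) (f : C(UnitAddCircle, ℂ))
    (g : L) : ρ f (T g) = T (σ f g) := by
  refine DFunLike.congr_fun (ContinuousLinearMap.ext_on
    (f := orbitMap ρ (T g)) (g := T ∘L orbitMap σ g)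
    (Submodule.dense_iff_topologicalClosure_eq_top.2 span_fourier_closure_eq_top) ?_) f
  rintro _ ⟨n, rfl⟩
  exact hT n g

theorem starAlgHom_fourier_mem {M : Submodule ℂ K} (hM : ∀ x ∈ M, ρ (fourier 1) x ∈ M) {n : ℤ}
    (hn : 0 ≤ n) {x : K} (hx : x ∈ M) : ρ (fourier n) x ∈ M := by
  induction n, hn using Int.leInduction with
  | base => rwa [starAlgHom_fourier_zero]
  | succ n _ ih =>
    rw [add_comm, starAlgHom_fourier_add]
    exact hM _ ih

/-- The vectors of `M` orthogonal to `z M`. -/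
def wandering (ρ : C(UnitAddCircle, ℂ) →⋆ₐ[ℂ] (K →L[ℂ] K)) (M : Submodule ℂ K) : Submodule ℂ K :=
  M ⊓ (M.map (ρ (fourier 1)).toLinearMap)ᗮ

theorem inner_starAlgHom_fourier_of_mem_wandering {M : Submodule ℂ K}
    (hM : ∀ x ∈ M, ρ (fourier 1) x ∈ M) {e x : K} (he : e ∈ wandering ρ M) (hx : x ∈ M) {n : ℤ}
    (hn : 0 < n) : ⟪ρ (fourier n) x, e⟫_ℂ = 0 := by
  have h : ρ (fourier n) x = ρ (fourier 1) (ρ (fourier (n - 1)) x) := by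
    rw [← starAlgHom_fourier_add, add_sub_cancel]
  rw [h]
  exact (Submodule.mem_orthogonal _ _).1 he.2 _
    ⟨_, starAlgHom_fourier_mem hM (by omega) hx, rfl⟩

theorem starAlgHom_mem_of_wandering_eq_bot {M : Submodule ℂ K} (hcl : IsClosed (M : Set K))
    (hM : ∀ x ∈ M, ρ (fourier 1) x ∈ M) (hw : wandering ρ M = ⊥) {x : K} (hx : x ∈ M)
    (f : C(UnitAddCircle, ℂ)) : ρ f x ∈ M := by
  have hiso : Isometry (ρ (fourier 1)) :=
    AddMonoidHomClass.isometry_of_norm _ (norm_starAlgHom_fourier ρ 1)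
  have : CompleteSpace (M.map (ρ (fourier 1)).toLinearMap) :=
    (hiso.isClosedEmbedding.isClosedMap _ hcl).completeSpace_coe
  have hmap : M.map (ρ (fourier 1)).toLinearMap = M := by
    have h := Submodule.sup_orthogonal_inf_of_hasOrthogonalProjection
      (Submodule.map_le_iff_le_comap.2 hM)
    rwa [inf_comm, ← wandering, hw, sup_bot_eq] at h
  have hinv : ∀ y ∈ M, ρ (fourier (-1)) y ∈ M := by
    rw [← hmap]
    rintro _ ⟨y, hy, rfl⟩
    rw [ContinuousLinearMap.coe_coe, ← starAlgHom_fourier_add, neg_add_cancel,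
      starAlgHom_fourier_zero, hmap]
    exact hy
  refine starAlgHom_mem_of_fourier_mem hcl (fun n => ?_) f
  induction n using Int.induction_on with
  | zero => rwa [starAlgHom_fourier_zero]
  | succ n ih =>
    rw [add_comm, starAlgHom_fourier_add]
    exact hM _ ih
  | pred n ih =>
    rw [sub_eq_neg_add, starAlgHom_fourier_add]
    exact hinv _ ih

end CircleRep

section Multiplication

theorem mulL2_fourier (m n : ℤ) :
    mulL2 (fourier m) (fourierLp 2 n) = fourierLp (T := 1) 2 (m + n) := by
  refine Lp.ext ?_
  filter_upwards [coeFn_mulL2 (fourier m) (fourierLp 2 n), coeFn_fourierLp (T := 1) 2 n,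
    coeFn_fourierLp (T := 1) 2 (m + n)] with t h1 h2 h3
  rw [h1, h2, h3, fourier_add]

theorem inner_mulL2_left (p : C(UnitAddCircle, ℂ)) (f g : L2) :
    ⟪mulL2 p f, g⟫_ℂ = ⟪f, mulL2 (star p) g⟫_ℂ := by
  rw [L2.inner_def, L2.inner_def]
  refine integral_congr_ae ?_
  filter_upwards [coeFn_mulL2 p f, coeFn_mulL2 (star p) g] with t h1 h2
  rw [h1, h2]
  simp only [RCLike.inner_apply, ContinuousMap.star_apply, RCLike.star_def, map_mul]
  ring

theorem mulL2_algebraMap (r : ℂ) : mulL2 (algebraMap ℂ _ r) = algebraMap ℂ _ r := by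
  ext1 f
  refine Lp.ext ?_
  filter_upwards [coeFn_mulL2 (algebraMap ℂ _ r) f, Lp.coeFn_smul r f] with t h1 h2
  exact h1.trans h2.symm

/-- The representation of the continuous functions by multiplication operators on `L²`. -/
def mulRep : C(UnitAddCircle, ℂ) →⋆ₐ[ℂ] (L2 →L[ℂ] L2) where
  toFun := mulL2
  map_one' := by simpa only [map_one] using mulL2_algebraMap 1
  map_mul' f g := ContinuousLinearMap.ext (mulL2_mul f g)
  map_zero' := by simpa only [map_zero] using mulL2_algebraMap 0
  map_add' f g := by
    ext1 h
    simp [mulL2]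
  commutes' := mulL2_algebraMap
  map_star' p := (ContinuousLinearMap.eq_adjoint_iff _ _).2 fun f g => by
    rw [inner_mulL2_left, star_star]

variable {K : Type v} [NormedAddCommGroup K] [InnerProductSpace ℂ K] [CompleteSpace K]
  {ρ : C(UnitAddCircle, ℂ) →⋆ₐ[ℂ] (K →L[ℂ] K)}

theorem orthonormal_starAlgHom_fourier {e : K} (he : ‖e‖ = 1)
    (hort : ∀ n : ℤ, 0 < n → ⟪ρ (fourier n) e, e⟫_ℂ = 0) :
    Orthonormal ℂ fun n : ℤ => ρ (fourier n) e := by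
  refine ⟨fun n => (norm_starAlgHom_fourier ρ n e).trans he, fun m n hmn => ?_⟩
  rcases hmn.lt_or_gt with h | h
  · rw [inner_starAlgHom_fourier_fourier, ← inner_conj_symm, hort _ (sub_pos.2 h), map_zero]
  · rw [← inner_conj_symm, inner_starAlgHom_fourier_fourier, ← inner_conj_symm,
      hort _ (sub_pos.2 h), map_zero, map_zero]

theorem exists_intertwiner {e : K} (he : ‖e‖ = 1)
    (hort : ∀ n : ℤ, 0 < n → ⟪ρ (fourier n) e, e⟫_ℂ = 0) :
    ∃ J : L2 →ₗᵢ[ℂ] K, (∀ f g, ρ f (J g) = J (mulL2 f g)) ∧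
      ∀ n : ℤ, J (fourierLp 2 n) = ρ (fourier n) e := by
  have hon := orthonormal_starAlgHom_fourier he hort
  let J : L2 →ₗᵢ[ℂ] K := hon.orthogonalFamily.linearIsometry.comp
    (fourierBasis (T := 1)).repr.toLinearIsometry
  have hJ (n : ℤ) : J (fourierLp 2 n) = ρ (fourier n) e := by
    change hon.orthogonalFamily.linearIsometry ((fourierBasis (T := 1)).repr (fourierLp 2 n)) = _
    rw [← coe_fourierBasis, HilbertBasis.repr_self, OrthogonalFamily.linearIsometry_apply_single]
    simp
  have hfourier (n : ℤ) (g : L2) : ρ (fourier n) (J g) = J (mulL2 (fourier n) g) := by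
    refine DFunLike.congr_fun (ContinuousLinearMap.ext_on
      (f := ρ (fourier n) ∘L J.toContinuousLinearMap)
      (g := J.toContinuousLinearMap ∘L mulL2 (fourier n))
      (Submodule.dense_iff_topologicalClosure_eq_top.2
        (span_fourierLp_closure_eq_top (T := 1) (p := 2) ENNReal.ofNat_ne_top)) ?_) g
    rintro _ ⟨k, rfl⟩
    change ρ (fourier n) (J (fourierLp 2 k)) = J (mulL2 (fourier n) (fourierLp 2 k))
    rw [mulL2_fourier, hJ, hJ, starAlgHom_fourier_add]
  exact ⟨J, starAlgHom_intertwine (σ := mulRep) J.toContinuousLinearMap hfourier, hJ⟩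

end Multiplication

/-! ### The model theorem -/

section HardySpace

theorem isClosed_H2 : IsClosed (H2 : Set L2) := by
  have h : (H2 : Set L2) = ⋂ n : ℤ, ⋂ _ : n < 0, {f | ⟪fourierLp (T := 1) 2 n, f⟫_ℂ = 0} := by
    ext f
    simp only [Set.mem_iInter]
    rfl
  rw [h]
  exact isClosed_iInter fun n => isClosed_iInter fun _ => isClosed_eq (by fun_prop) (by fun_prop)

theorem fourierLp_mem_H2 {n : ℤ} (hn : 0 ≤ n) : fourierLp (T := 1) 2 n ∈ H2 :=
  fun _ hm => orthonormal_fourier.2 (by omega)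

theorem hasSum_fourierLp (f : L2) :
    HasSum (fun n : ℤ => ⟪fourierLp (T := 1) 2 n, f⟫_ℂ • fourierLp (T := 1) 2 n) f := by
  simpa only [HilbertBasis.repr_apply_apply, coe_fourierBasis]
    using (fourierBasis (T := 1)).hasSum_repr f

theorem mem_of_mem_H2 {S : Submodule ℂ L2} (hS : IsClosed (S : Set L2))
    (h : ∀ n : ℤ, 0 ≤ n → fourierLp 2 n ∈ S) {f : L2} (hf : f ∈ H2) : f ∈ S := by
  refine hS.mem_of_tendsto (hasSum_fourierLp f)
    (Filter.Eventually.of_forall fun s => sum_mem fun n _ => ?_)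
  rcases lt_or_ge n 0 with hn | hn
  · rw [hf n hn, zero_smul]
    exact S.zero_mem
  · exact S.smul_mem _ (h n hn)

theorem mem_CCz_of_inner_eq_zero {f : L2} (hf : f ∈ H2)
    (h : ∀ n : ℤ, 2 ≤ n → ⟪fourierLp (T := 1) 2 n, f⟫_ℂ = 0) : f ∈ CCz := by
  have hsum : f = ∑ n ∈ {0, 1}, ⟪fourierLp (T := 1) 2 n, f⟫_ℂ • fourierLp (T := 1) 2 n := by
    refine (hasSum_fourierLp f).unique (hasSum_sum_of_ne_finset_zero fun n hn => ?_)
    simp only [Finset.mem_insert, Finset.mem_singleton, not_or] at hn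
    rcases lt_or_ge n 0 with hn0 | hn0
    · rw [hf n hn0, zero_smul]
    · rw [h n (by omega), zero_smul]
  rw [Finset.sum_pair zero_ne_one] at hsum
  exact Submodule.mem_span_pair.2 ⟨_, _, hsum.symm⟩

theorem exists_H2V_eq {N : Submodule ℂ L2} (hN : IsClosed (N : Set L2)) (hNH : N ≤ H2)
    (hz : ∀ n : ℤ, 2 ≤ n → fourierLp 2 n ∈ N) : ∃ W ≤ CCz, H2V W = N := by
  have : CompleteSpace N := hN.completeSpace_coe
  refine ⟨H2 ⊓ Nᗮ, fun f hf => mem_CCz_of_inner_eq_zero hf.1 fun n hn =>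
    (Submodule.mem_orthogonal _ _).1 hf.2 _ (hz n hn), ?_⟩
  refine le_antisymm (fun f hf => ?_) fun f hf => ⟨hNH hf, (Submodule.mem_orthogonal _ _).2
    fun v hv => (Submodule.mem_orthogonal' _ _).1 hv.2 f hf⟩
  obtain ⟨p, hp, q, hq, rfl⟩ := N.exists_add_mem_mem_orthogonal f
  have hqH : q ∈ H2 := (add_sub_cancel_left p q) ▸ H2.sub_mem hf.1 (hNH hp)
  have hqq : ⟪q, p + q⟫_ℂ = 0 := (Submodule.mem_orthogonal _ _).1 hf.2 q ⟨hqH, hq⟩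
  rw [inner_add_right, (Submodule.mem_orthogonal' _ _).1 hq p hp, zero_add,
    inner_self_eq_zero] at hqq
  rwa [hqq, add_zero]

end HardySpace

section CyclicSubspaces

variable {H : Type u} [NormedAddCommGroup H] [InnerProductSpace ℂ H] {π : Rep H}

/-- The closed invariant subspace generated by `x` (for unital `π`). -/
def cyclic (π : Rep H) (x : H) : Submodule ℂ H :=
  (LinearMap.range ((ContinuousLinearMap.apply ℂ H x).toLinearMap ∘ₗ
    (π : neilAlgebra →ₗ[ℂ] (H →L[ℂ] H)))).topologicalClosure

theorem apply_mem_cyclic (π : Rep H) (a : neilAlgebra) (x : H) : π a x ∈ cyclic π x :=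
  subset_closure ⟨a, rfl⟩

theorem cyclic_le {x : H} {N : Submodule ℂ H} (hN : IsClosed (N : Set H))
    (h : ∀ a, π a x ∈ N) : cyclic π x ≤ N :=
  Submodule.topologicalClosure_minimal _ (by rintro _ ⟨a, rfl⟩; exact h a) hN

theorem isClosed_cyclic (x : H) : IsClosed (cyclic π x : Set H) :=
  Submodule.isClosed_topologicalClosure _

theorem isInvariant_cyclic (x : H) : IsInvariant π (cyclic π x) := by
  intro b
  refine cyclic_le (N := (cyclic π x).comap (π b).toLinearMap)
    ((isClosed_cyclic x).preimage (π b).continuous) fun a => ?_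
  rw [Submodule.mem_comap, ContinuousLinearMap.coe_coe, ← mul_apply_eq_comp, ← map_mul]
  exact apply_mem_cyclic π _ x

theorem isOrtho_cyclic {x y : H} (h : ∀ a b, ⟪π a x, π b y⟫_ℂ = 0) :
    cyclic π x ⟂ cyclic π y := by
  refine cyclic_le (Submodule.isClosed_orthogonal _) fun a => ?_
  refine (Submodule.mem_orthogonal' _ _).2 fun w hw => ?_
  rw [← Submodule.mem_orthogonal_singleton_iff_inner_right]
  exact cyclic_le (Submodule.isClosed_orthogonal _)
    (fun b => Submodule.mem_orthogonal_singleton_iff_inner_right.2 (h a b)) hw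

theorem IsUnital.cyclic_ne_bot (hu : IsUnital π) {x : H} (hx : x ≠ 0) : cyclic π x ≠ ⊥ := by
  have hmem := apply_mem_cyclic π 1 x
  rw [show π 1 = 1 from hu, one_apply_eq_self] at hmem
  exact (Submodule.ne_bot_iff _).2 ⟨x, hmem, hx⟩

theorem IsRankOne.eq_zero_or_eq_zero (hr : IsRankOne π) (hu : IsUnital π) {x y : H}
    (h : ∀ a b, ⟪π a x, π b y⟫_ℂ = 0) : x = 0 ∨ y = 0 := by
  by_contra! hxy
  exact hr ⟨cyclic π x, cyclic π y, isClosed_cyclic x, isClosed_cyclic y,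
    hu.cyclic_ne_bot hxy.1, hu.cyclic_ne_bot hxy.2, isOrtho_cyclic h, isInvariant_cyclic x,
    isInvariant_cyclic y⟩

end CyclicSubspaces

section Saturation

variable {K : Type v} [NormedAddCommGroup K] [InnerProductSpace ℂ K] [CompleteSpace K]
  {ρ : C(UnitAddCircle, ℂ) →⋆ₐ[ℂ] (K →L[ℂ] K)} {P : Submodule ℂ K}

/-- The largest `z`-invariant subspace `M` with `z² M ⊆ P`. -/
def saturation (ρ : C(UnitAddCircle, ℂ) →⋆ₐ[ℂ] (K →L[ℂ] K)) (P : Submodule ℂ K) :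
    Submodule ℂ K :=
  ⨅ n : Set.Ici (2 : ℤ), P.comap (ρ (fourier n)).toLinearMap

theorem mem_saturation {x : K} : x ∈ saturation ρ P ↔ ∀ n : ℤ, 2 ≤ n → ρ (fourier n) x ∈ P := by
  simp [saturation, Submodule.mem_iInf]

theorem isClosed_saturation (hP : IsClosed (P : Set K)) :
    IsClosed (saturation ρ P : Set K) := by
  rw [saturation, Submodule.coe_iInf]
  exact isClosed_iInter fun n => hP.preimage (ρ (fourier n)).continuous

theorem starAlgHom_fourier_one_mem_saturation {x : K} (hx : x ∈ saturation ρ P) :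
    ρ (fourier 1) x ∈ saturation ρ P := by
  refine mem_saturation.2 fun n hn => ?_
  rw [← starAlgHom_fourier_add]
  exact mem_saturation.1 hx _ (by omega)

end Saturation

section WoldModel

variable {K : Type v} [NormedAddCommGroup K] [InnerProductSpace ℂ K] [CompleteSpace K]
  {ρ : C(UnitAddCircle, ℂ) →⋆ₐ[ℂ] (K →L[ℂ] K)} {M : Submodule ℂ K} {J : L2 →ₗᵢ[ℂ] K} {e : K}

theorem map_H2_le (hcl : IsClosed (M : Set K)) (hM : ∀ x ∈ M, ρ (fourier 1) x ∈ M) (he : e ∈ M)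
    (hJ : ∀ n : ℤ, J (fourierLp 2 n) = ρ (fourier n) e) : H2.map J.toLinearMap ≤ M := by
  refine Submodule.map_le_iff_le_comap.2 fun f hf => mem_of_mem_H2
    (hcl.preimage J.continuous) (fun n hn => ?_) hf
  rw [Submodule.mem_comap, LinearIsometry.coe_toLinearMap, hJ]
  exact starAlgHom_fourier_mem hM hn he

theorem inner_starAlgHom_eq_zero_of_mem_orthogonal (hM : ∀ x ∈ M, ρ (fourier 1) x ∈ M)
    (he : e ∈ wandering ρ M) (hJ : ∀ n : ℤ, J (fourierLp 2 n) = ρ (fourier n) e) {q : K}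
    (hqM : q ∈ M) (hq : q ∈ (H2.map J.toLinearMap)ᗮ) (f : C(UnitAddCircle, ℂ)) :
    ⟪ρ f e, q⟫_ℂ = 0 := by
  refine inner_starAlgHom_eq_zero (fun n => ?_) f
  rcases lt_or_ge n 0 with hn | hn
  · rw [inner_starAlgHom_fourier_left, ← inner_conj_symm,
      inner_starAlgHom_fourier_of_mem_wandering hM he hqM (by omega), map_zero]
  · rw [← hJ]
    exact (Submodule.mem_orthogonal _ _).1 hq _ ⟨_, fourierLp_mem_H2 hn, rfl⟩

theorem map_H2_eq (hcl : IsClosed (M : Set K)) (hM : ∀ x ∈ M, ρ (fourier 1) x ∈ M)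
    (he : e ∈ wandering ρ M) (he0 : e ≠ 0)
    (hJ : ∀ n : ℤ, J (fourierLp 2 n) = ρ (fourier n) e)
    (hrank : ∀ x ∈ M, ∀ y ∈ M, (∀ f, ⟪ρ f x, y⟫_ℂ = 0) → x = 0 ∨ y = 0) :
    H2.map J.toLinearMap = M := by
  have : CompleteSpace (H2.map J.toLinearMap) :=
    (J.isometry.isClosedEmbedding.isClosedMap _ isClosed_H2).completeSpace_coe
  have hsup := Submodule.sup_orthogonal_inf_of_hasOrthogonalProjection (map_H2_le hcl hM he.1 hJ)
  have hbot : (H2.map J.toLinearMap)ᗮ ⊓ M = ⊥ := (Submodule.eq_bot_iff _).2 fun q hq =>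
    (hrank e he.1 q hq.2
      (inner_starAlgHom_eq_zero_of_mem_orthogonal hM he hJ hq.2 hq.1)).resolve_left he0
  rwa [hbot, sup_bot_eq] at hsup

end WoldModel

section Model

variable {H : Type u} [NormedAddCommGroup H] [InnerProductSpace ℂ H] {π : Rep H}
  {K : Type v} [NormedAddCommGroup K] [InnerProductSpace ℂ K] [CompleteSpace K]
  {ρ : C(UnitAddCircle, ℂ) →⋆ₐ[ℂ] (K →L[ℂ] K)} {V : H →ₗᵢ[ℂ] K}

theorem range_le_saturation (hV : ∀ (a : neilAlgebra) h, V (π a h) = ρ (bdry a) (V h)) :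
    LinearMap.range V.toLinearMap ≤ saturation ρ (LinearMap.range V.toLinearMap) := by
  rintro _ ⟨h, rfl⟩
  refine mem_saturation.2 fun n hn => ?_
  lift n to ℕ using by omega
  rw [← bdry_monomial n (by omega)]
  exact ⟨_, hV _ h⟩

theorem IsPure.eq_zero_of_reducing (hp : IsPure π)
    (hV : ∀ (a : neilAlgebra) h, V (π a h) = ρ (bdry a) (V h))
    (hred : ∀ f h, ∃ g, V g = ρ f (V h)) (h : H) : h = 0 := by
  refine hp h fun a ha => ?_
  obtain ⟨g, hg⟩ := hred (star (bdry a)) h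
  refine ⟨g, V.injective ?_⟩
  rw [hV, hg, ← starAlgHom_mul_apply, mul_comm, ha.star_bdry_mul_bdry, map_one, one_apply_eq_self]

theorem IsPure.wandering_saturation_ne_bot [CompleteSpace H] [Nontrivial H] (hp : IsPure π)
    (hV : ∀ (a : neilAlgebra) h, V (π a h) = ρ (bdry a) (V h)) :
    wandering ρ (saturation ρ (LinearMap.range V.toLinearMap)) ≠ ⊥ := by
  intro hw
  obtain ⟨h, hh⟩ := exists_ne (0 : H)
  refine hh (hp.eq_zero_of_reducing hV (fun f k => ?_) h)
  have hmem : ρ (fourier (-2) * f) (V k) ∈ saturation ρ (LinearMap.range V.toLinearMap) :=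
    starAlgHom_mem_of_wandering_eq_bot
      (isClosed_saturation V.isometry.isClosedEmbedding.isClosed_range)
      (fun _ => starAlgHom_fourier_one_mem_saturation) hw (range_le_saturation hV ⟨k, rfl⟩) _
  have h2 := mem_saturation.1 hmem 2 le_rfl
  rwa [starAlgHom_mul_apply, ← starAlgHom_fourier_add, add_neg_cancel,
    starAlgHom_fourier_zero] at h2

theorem IsRankOne.eq_zero_or_eq_zero_of_mem_saturation (hr : IsRankOne π) (hu : IsUnital π)
    (hV : ∀ (a : neilAlgebra) h, V (π a h) = ρ (bdry a) (V h)) {x y : K}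
    (hx : x ∈ saturation ρ (LinearMap.range V.toLinearMap))
    (hy : y ∈ saturation ρ (LinearMap.range V.toLinearMap)) (hxy : ∀ f, ⟪ρ f x, y⟫_ℂ = 0) :
    x = 0 ∨ y = 0 := by
  obtain ⟨x', hx'⟩ := mem_saturation.1 hx 2 le_rfl
  obtain ⟨y', hy'⟩ := mem_saturation.1 hy 2 le_rfl
  rw [LinearIsometry.coe_toLinearMap] at hx' hy'
  have hort (a b : neilAlgebra) : ⟪π a x', π b y'⟫_ℂ = 0 := by
    rw [← V.inner_map_map, hV, hV, hx', hy', ← starAlgHom_mul_apply, ← starAlgHom_mul_apply,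
      ← star_star (bdry (b : C(Disc, ℂ)) * fourier 2), ← inner_starAlgHom_left,
      ← starAlgHom_mul_apply]
    exact hxy _
  refine (hr.eq_zero_or_eq_zero hu hort).imp (fun h => ?_) (fun h => ?_)
  · rw [← norm_eq_zero, ← norm_starAlgHom_fourier ρ 2, ← hx', h, map_zero, norm_zero]
  · rw [← norm_eq_zero, ← norm_starAlgHom_fourier ρ 2, ← hy', h, map_zero, norm_zero]

theorem unitarilyEquiv_of_map_eq_range {J : L2 →ₗᵢ[ℂ] K}
    (hV : ∀ (a : neilAlgebra) h, V (π a h) = ρ (bdry a) (V h))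
    (hJ : ∀ f g, ρ f (J g) = J (mulL2 f g)) {W : Submodule ℂ L2} (hW : W ≤ CCz)
    (hVJ : (H2V W).map J.toLinearMap = LinearMap.range V.toLinearMap) :
    UnitarilyEquiv π (piV W hW) := by
  let T : H2V W →ₗᵢ[ℂ] K := J.comp (H2V W).subtypeₗᵢ
  have hrange : LinearMap.range V.toLinearMap = LinearMap.range T.toLinearMap := by
    rw [← hVJ]
    ext x
    simp [T]
  let U : H ≃ₗᵢ[ℂ] H2V W := V.equivRange.trans
    ((LinearIsometryEquiv.ofEq _ _ hrange).trans T.equivRange.symm)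
  have hU (h : H) : T (U h) = V h := congrArg Subtype.val (T.equivRange.apply_symm_apply
    (LinearIsometryEquiv.ofEq _ _ hrange (V.equivRange h)))
  refine ⟨U, fun a h => T.injective ?_⟩
  rw [hU, hV, ← hU]
  exact hJ _ _

theorem exists_unitarilyEquiv_piV [CompleteSpace H] [Nontrivial H] (hu : IsUnital π)
    (hp : IsPure π) (he : IsExtremal π) (hc : IsCompletelyContractive π) (hr : IsRankOne π) :
    ∃ (W : Submodule ℂ L2) (hW : W ≤ CCz), UnitarilyEquiv π (piV W hW) := by
  obtain ⟨K, _, _, _, ρ, V, hV⟩ := he.exists_extension hu hc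
  set P := LinearMap.range V.toLinearMap
  have hPcl : IsClosed (P : Set K) := V.isometry.isClosedEmbedding.isClosed_range
  obtain ⟨e, hew, he1⟩ : ∃ e ∈ wandering ρ (saturation ρ P), ‖e‖ = 1 := by
    obtain ⟨e, he, he0⟩ :=
      Submodule.exists_mem_ne_zero_of_ne_bot (hp.wandering_saturation_ne_bot hV)
    exact ⟨_, Submodule.smul_mem _ _ he, norm_smul_inv_norm (𝕜 := ℂ) he0⟩
  have hz : ∀ x ∈ saturation ρ P, ρ (fourier 1) x ∈ saturation ρ P :=
    fun _ => starAlgHom_fourier_one_mem_saturation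
  obtain ⟨J, hJρ, hJe⟩ := exists_intertwiner he1 fun n hn =>
    inner_starAlgHom_fourier_of_mem_wandering hz hew hew.1 hn
  have hJ : H2.map J.toLinearMap = saturation ρ P :=
    map_H2_eq (isClosed_saturation hPcl) hz hew (norm_ne_zero_iff.1 (by simp [he1])) hJe
      fun x hx y hy => hr.eq_zero_or_eq_zero_of_mem_saturation hu hV hx hy
  have hPJ : P ≤ H2.map J.toLinearMap := hJ ▸ range_le_saturation hV
  obtain ⟨W, hW, hWP⟩ := exists_H2V_eq (N := P.comap J.toLinearMap)
    (hPcl.preimage J.continuous)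
    (fun f hf => by obtain ⟨g, hg, hgf⟩ := hPJ hf; rwa [← J.injective hgf])
    fun n hn => by
      rw [Submodule.mem_comap, LinearIsometry.coe_toLinearMap, hJe]
      exact mem_saturation.1 hew.1 n hn
  refine ⟨W, hW, unitarilyEquiv_of_map_eq_range hV hJρ hW ?_⟩
  rw [hWP, Submodule.map_comap_eq_self (hPJ.trans (LinearMap.map_le_range))]

end Model

/-! ### The model representations have rank one -/

section IntegralTest

variable {X E : Type*} [TopologicalSpace X] [HasOuterApproxClosed X] [MeasurableSpace X]
  [BorelSpace X] {μ : Measure X} [NormedAddCommGroup E] [NormedSpace ℝ E] {f : X → E}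

theorem tendsto_integral_apprSeq_smul (hf : Integrable f μ) {s : Set X} (hs : IsClosed s) :
    Filter.Tendsto (fun n => ∫ x, (hs.apprSeq n x : ℝ) • f x ∂μ) Filter.atTop
      (nhds (∫ x in s, f x ∂μ)) := by
  rw [← integral_indicator hs.measurableSet]
  refine tendsto_integral_of_dominated_convergence (fun x => ‖f x‖) (fun n => ?_) hf.norm
    (fun n => .of_forall fun x => ?_) (.of_forall fun x => ?_)
  · exact (by fun_prop : Continuous fun x => (hs.apprSeq n x : ℝ)).aestronglyMeasurable.smul hf.1
  · rw [norm_smul, NNReal.norm_eq]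
    exact mul_le_of_le_one_left (norm_nonneg _) (HasOuterApproxClosed.apprSeq_apply_le_one hs n x)
  · have hind : s.indicator f x = ((s.indicator (fun _ => 1) x : NNReal) : ℝ) • f x := by
      by_cases hx : x ∈ s <;> simp [hx]
    rw [hind]
    exact ((NNReal.continuous_coe.tendsto _).comp
      (tendsto_pi_nhds.1 (HasOuterApproxClosed.tendsto_apprSeq hs) x)).smul_const _

theorem ae_eq_zero_of_forall_integral_boundedContinuous_smul [CompleteSpace E]
    (hf : Integrable f μ)
    (h : ∀ p : BoundedContinuousFunction X NNReal, ∫ x, (p x : ℝ) • f x ∂μ = 0) :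
    f =ᵐ[μ] 0 := by
  refine ae_eq_zero_of_forall_setIntegral_isClosed_eq_zero hf fun s hs => ?_
  have hlim := tendsto_integral_apprSeq_smul hf hs
  simp only [h] at hlim
  exact tendsto_nhds_unique hlim tendsto_const_nhds

end IntegralTest

section RankOne

theorem ae_mul_eq_zero_of_inner_mulL2_eq_zero {f g : L2}
    (h : ∀ p : C(UnitAddCircle, ℂ), ⟪mulL2 p f, g⟫_ℂ = 0) :
    ∀ᵐ t ∂(haarAddCircle : Measure UnitAddCircle), f t * g t = 0 := by
  have hinner := ae_eq_zero_of_forall_integral_boundedContinuous_smul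
    (L2.integrable_inner (𝕜 := ℂ) f g) fun p => by
      let q : C(UnitAddCircle, ℂ) := ⟨fun t => ((p t : ℝ) : ℂ), by fun_prop⟩
      rw [← h q, L2.inner_def]
      refine integral_congr_ae ?_
      filter_upwards [coeFn_mulL2 q f] with t ht
      have hq : q t = ((p t : ℝ) : ℂ) := rfl
      rw [ht, hq, ← smul_eq_mul, inner_smul_left, Complex.conj_ofReal, Complex.real_smul]
  filter_upwards [hinner] with t ht
  simpa [or_comm] using ht

theorem hasSum_inner_fourierLp_mul (f g : L2) (n : ℤ) :
    HasSum (fun k : ℤ => ⟪fourierLp (T := 1) 2 (n - k), f⟫_ℂ * ⟪fourierLp (T := 1) 2 k, g⟫_ℂ)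
      (∫ t : UnitAddCircle, fourier (-n) t * (f t * g t) ∂haarAddCircle) := by
  -- Parseval for `g` and `w = zⁿ f̄`, whose coefficients are those of `f`, reflected and shifted.
  set w : L2 := mulL2 (fourier n) (star f)
  have hw : ∀ᵐ t ∂(haarAddCircle : Measure UnitAddCircle), w t = fourier n t * conj (f t) := by
    filter_upwards [coeFn_mulL2 (fourier n) (star f), Lp.coeFn_star f] with t h1 h2
    rw [h1, h2, Pi.star_apply, RCLike.star_def]
  have hcoeff (k : ℤ) : ⟪w, fourierLp (T := 1) 2 k⟫_ℂ = ⟪fourierLp (T := 1) 2 (n - k), f⟫_ℂ := by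
    rw [L2.inner_def, L2.inner_def]
    refine integral_congr_ae ?_
    filter_upwards [hw, coeFn_fourierLp (T := 1) 2 k, coeFn_fourierLp (T := 1) 2 (n - k)]
      with t h1 h2 h3
    simp only [RCLike.inner_apply, h1, h2, h3, map_mul, RCLike.conj_conj, ← fourier_neg]
    rw [neg_sub, sub_eq_add_neg, fourier_add]
    ring
  have hint : ⟪w, g⟫_ℂ = ∫ t : UnitAddCircle, fourier (-n) t * (f t * g t) ∂haarAddCircle := by
    rw [L2.inner_def]
    refine integral_congr_ae ?_
    filter_upwards [hw] with t ht
    simp only [RCLike.inner_apply, ht, map_mul, RCLike.conj_conj, ← fourier_neg]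
    ring
  simpa only [← hint, coe_fourierBasis, hcoeff]
    using (fourierBasis (T := 1)).hasSum_inner_mul_inner w g

/-- The Taylor series at the origin of the analytic function on the disc whose boundary values
are `f ∈ H²`; for general `f` the coefficients of negative index are dropped. -/
def taylorSeries (f : L2) : PowerSeries ℂ :=
  PowerSeries.mk fun n => ⟪fourierLp (T := 1) 2 (n : ℤ), f⟫_ℂ

theorem eq_zero_of_taylorSeries_eq_zero {f : L2} (hf : f ∈ H2) (h : taylorSeries f = 0) :
    f = 0 := by
  have hcoeff (n : ℤ) : ⟪fourierLp (T := 1) 2 n, f⟫_ℂ = 0 := by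
    rcases lt_or_ge n 0 with hn | hn
    · exact hf n hn
    · lift n to ℕ using hn
      simpa only [taylorSeries, PowerSeries.coeff_mk, map_zero]
        using congrArg (PowerSeries.coeff n) h
  refine (hasSum_fourierLp f).unique ?_
  simpa only [hcoeff, zero_smul] using hasSum_zero

theorem coeff_taylorSeries_mul {f g : L2} (hf : f ∈ H2) (hg : g ∈ H2) (n : ℕ) :
    PowerSeries.coeff n (taylorSeries f * taylorSeries g) =
      ∫ t : UnitAddCircle, fourier (-n : ℤ) t * (f t * g t) ∂haarAddCircle := by
  have hfin := hasSum_sum_of_ne_finset_zero (L := SummationFilter.unconditional ℤ)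
    (f := fun k : ℤ => ⟪fourierLp (T := 1) 2 (n - k), f⟫_ℂ * ⟪fourierLp (T := 1) 2 k, g⟫_ℂ)
    (s := (Finset.range (n + 1)).map Nat.castEmbedding) fun k hk => by
      rcases lt_or_ge k 0 with hk0 | hk0
      · rw [hg k hk0, mul_zero]
      · lift k to ℕ using hk0
        rw [hf _ ?_, zero_mul]
        by_contra hkn
        exact hk (Finset.mem_map.2 ⟨k, Finset.mem_range.2 (by omega), rfl⟩)
  rw [← hfin.unique (hasSum_inner_fourierLp_mul f g n), Finset.sum_map, PowerSeries.coeff_mul,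
    ← Finset.Nat.sum_antidiagonal_swap, Finset.Nat.sum_antidiagonal_eq_sum_range_succ_mk]
  refine Finset.sum_congr rfl fun k hk => ?_
  have hkn : k ≤ n := Nat.lt_succ_iff.1 (Finset.mem_range.1 hk)
  simp [taylorSeries, Nat.cast_sub hkn]

theorem eq_zero_or_eq_zero_of_ae_mul_eq_zero {f g : L2} (hf : f ∈ H2) (hg : g ∈ H2)
    (h : ∀ᵐ t ∂(haarAddCircle : Measure UnitAddCircle), f t * g t = 0) : f = 0 ∨ g = 0 := by
  have hmul : taylorSeries f * taylorSeries g = 0 := by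
    ext n
    rw [coeff_taylorSeries_mul hf hg, map_zero]
    refine integral_eq_zero_of_ae ?_
    filter_upwards [h] with t ht
    rw [ht, mul_zero, Pi.zero_apply]
  exact (mul_eq_zero.1 hmul).imp (eq_zero_of_taylorSeries_eq_zero hf)
    (eq_zero_of_taylorSeries_eq_zero hg)

theorem isRankOne_piV (W : Submodule ℂ L2) (hW : W ≤ CCz) : IsRankOne (piV W hW) := by
  rintro ⟨M, N, -, -, hM, hN, hMN, hMi, hNi⟩
  obtain ⟨f, hfM, hf0⟩ := (Submodule.ne_bot_iff M).1 hM
  obtain ⟨g, hgN, hg0⟩ := (Submodule.ne_bot_iff N).1 hN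
  have hmonomial (j k : ℕ) (hj : j ≠ 1) (hk : k ≠ 1) :
      ⟪mulRep (fourier (j : ℤ)) f, mulRep (fourier (k : ℤ)) g⟫_ℂ = 0 := by
    rw [← bdry_monomial j hj, ← bdry_monomial k hk]
    exact Submodule.isOrtho_iff_inner_eq.1 hMN _ (hMi (monomial j hj) f hfM) _
      (hNi (monomial k hk) g hgN)
  have hort (n : ℤ) : ⟪mulRep (fourier n) f, (g : L2)⟫_ℂ = 0 := by
    have h := hmonomial (n.toNat + 2) ((-n).toNat + 2) (by omega) (by omega)
    rwa [inner_starAlgHom_fourier_fourier,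
      show (((-n).toNat + 2 : ℕ) : ℤ) - (n.toNat + 2 : ℕ) = -n by omega,
      ← inner_starAlgHom_fourier_left] at h
  exact (eq_zero_or_eq_zero_of_ae_mul_eq_zero f.2.1 g.2.1
    (ae_mul_eq_zero_of_inner_mulL2_eq_zero (inner_starAlgHom_eq_zero (ρ := mulRep) hort))).elim
    (fun h => hf0 (Subtype.ext h)) (fun h => hg0 (Subtype.ext h))

end RankOne

end NeilAlg

end

theorem corollary4p2 :
    (∀ (V : Submodule ℂ NeilAlg.L2) (hV : V ≤ NeilAlg.CCz),
      NeilAlg.IsRankOne (NeilAlg.piV V hV)) ∧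
    (∀ (H : Type u) [NormedAddCommGroup H] [InnerProductSpace ℂ H] [CompleteSpace H]
      [Nontrivial H] (π : NeilAlg.Rep H),
      NeilAlg.IsUnital π → NeilAlg.IsPure π → NeilAlg.IsExtremal π →
      NeilAlg.IsCompletelyContractive π → NeilAlg.IsRankOne π →
      ∃ (V : Submodule ℂ NeilAlg.L2) (hV : V ≤ NeilAlg.CCz),
        NeilAlg.UnitarilyEquiv π (NeilAlg.piV V hV)) :=
  ⟨NeilAlg.isRankOne_piV, fun _ _ _ _ _ _ hu hp he hc hr =>
    NeilAlg.exists_unitarilyEquiv_piV hu hp he hc hr⟩
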